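/- Graphs are finite and undirected; multiple edges are allowed. A $(p,q)$-semi-regular bipartite graph is a graph whose vertex set is partitioned into two non-empty sets $A,B$ such that every edge has one end in $A$ and the other in $B$, every vertex of $A$ has degree $p$ and every vertex of $B$ has degree $q$. The join $G\vee H$ is the disjoint union of $G$ and $H$ together with one new edge $vw$ for every pair of vertices $v\in V(G)$, $w\in V(H)$. The spectrum $\mathrm{spec}(G)$ is the multiset of all zeros, counted with multiplicity, of the characteristic polynomial of the adjacency matrix of $G$. The Ihara zeta function of $G$ is $$Z_G(u)=\prod_{[C]}\bigl(1-u^{|C|}\bigr)^{-1}$$ for $u\in\mathbb C$ with $|u|$ sufficiently small, where $[C]$ runs over the equivalence classes, under change of the starting point, of closed paths $C$ of positive length $|C|$ (sequences of oriented edges) that are primitive (not a $k$-fold repetition of a closed path for any $k\ge 2$), backtrackless (no edge is immediately followed by its reverse) and tailless (the last edge is not the reverse of the first). Theorem. Let $G_1$ be a $(q_1,q_2)$-semi-regular bipartite graph, $G_2$ a $(q_3,q_4)$-semi-regular bipartite graph and $G_2'$ a $(q_3',q_4')$-semi-regular bipartite graph. Let $G=G_1\vee G_2$ and $G'=G_1\vee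 G_2'$. Then the products defining $Z_G(u)$ and $Z_{G'}(u)$ converge for all sufficiently small $|u|$, and $Z_G(u)=Z_{G'}(u)$ for all sufficiently small $|u|$ if and only if $\mathrm{spec}(G)=\mathrm{spec}(G')$. -/

import Mathlib

open Filter Topology

/-- A graph (undirected, multiple edges and loops allowed) with vertex set `V`, given by its set `D`
of oriented edges. Every edge has exactly two orientations, exchanged by the fixed-point-free
involution `inv`; so edges are the pairs `{d, inv d}`, and a loop also has two orientations. -/
structure OrientedEdgeGraph (V D : Type*) where
  /-- the initial vertex of an oriented edge -/
  src : D → V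
  /-- the same edge with the opposite orientation -/
  inv : D → D
  inv_inv : ∀ d, inv (inv d) = d
  inv_ne : ∀ d, inv d ≠ d

namespace OrientedEdgeGraph

variable {V W D D' : Type*}

/-- The terminal vertex of an oriented edge. -/
def tgt (G : OrientedEdgeGraph V D) (d : D) : V := G.src (G.inv d)

/-- The degree of a vertex: the number of edges at `v`, each loop counted twice. -/
noncomputable def degree (G : OrientedEdgeGraph V D) (v : V) : ℕ :=
  Nat.card {d : D // G.src d = v}

/-- The adjacency matrix: entry `(v, w)` is the number of edges joining `v` and `w`, where each loop
counts as two edges. -/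
noncomputable def adjMatrix (G : OrientedEdgeGraph V D) : Matrix V V ℂ :=
  Matrix.of fun v w => (Nat.card {d : D // G.src d = v ∧ G.tgt d = w} : ℂ)

/-- The spectrum: the multiset of all zeros, with multiplicity, of the characteristic polynomial of
the adjacency matrix. -/
noncomputable def spec [Fintype V] [DecidableEq V] (G : OrientedEdgeGraph V D) : Multiset ℂ :=
  G.adjMatrix.charpoly.roots

/-- `G` is a `(p, q)`-semi-regular bipartite graph: its vertex set is partitioned into non-empty
sets `A` and `B` such that every edge has one end in `A` and the other end in `B`, all vertices
of `A` have degree `p`, and all vertices of `B` have degree `q`. -/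
def IsSemiregularBipartite (G : OrientedEdgeGraph V D) (p q : ℕ) : Prop :=
  ∃ A B : Set V, A.Nonempty ∧ B.Nonempty ∧ Disjoint A B ∧ A ∪ B = Set.univ ∧
    (∀ d, (G.src d ∈ A ∧ G.tgt d ∈ B) ∨ (G.src d ∈ B ∧ G.tgt d ∈ A)) ∧
    (∀ v ∈ A, G.degree v = p) ∧ (∀ v ∈ B, G.degree v = q)

/-- The join: the disjoint union of `G` and `H` together with one new edge `vw` for every vertex `v`
of `G` and every vertex `w` of `H`. The oriented edges `(v, w)` and `(w, v)` are the two
orientations of the new edge `vw`. -/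
def join (G : OrientedEdgeGraph V D) (H : OrientedEdgeGraph W D') :
    OrientedEdgeGraph (V ⊕ W) ((D ⊕ D') ⊕ (V × W ⊕ W × V)) where
  src
    | .inl (.inl d) => .inl (G.src d)
    | .inl (.inr d) => .inr (H.src d)
    | .inr (.inl e) => .inl e.1
    | .inr (.inr e) => .inr e.1
  inv
    | .inl (.inl d) => .inl (.inl (G.inv d))
    | .inl (.inr d) => .inl (.inr (H.inv d))
    | .inr (.inl e) => .inr (.inr e.swap)
    | .inr (.inr e) => .inr (.inl e.swap)
  inv_inv := by
    rintro ((d | d) | (e | e)) <;> simp [G.inv_inv, H.inv_inv]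
  inv_ne := by
    rintro ((d | d) | (e | e)) <;> simp [G.inv_ne, H.inv_ne]

/-- A closed path of positive length, as the list of its successive oriented edges. -/
def IsClosedPath (G : OrientedEdgeGraph V D) (l : List D) : Prop :=
  l.IsChain (fun d e => G.tgt d = G.src e) ∧
    ∃ h : l ≠ [], G.tgt (l.getLast h) = G.src (l.head h)

/-- No edge is followed immediately by its reverse. -/
def IsBacktrackless (G : OrientedEdgeGraph V D) (l : List D) : Prop :=
  l.IsChain (fun d e => e ≠ G.inv d)

/-- The last edge is not the reverse of the first edge. -/
def IsTailless (G : OrientedEdgeGraph V D) (l : List D) : Prop :=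
  ∀ h : l ≠ [], l.getLast h ≠ G.inv (l.head h)

/-- `l` is not obtained by going `k ≥ 2` times around another closed path. -/
def IsPrimitive (l : List D) : Prop :=
  ∀ (m : List D) (k : ℕ), 2 ≤ k → l ≠ (List.replicate k m).flatten

/-- The equivalence classes of primitive, backtrackless, tailless closed paths. Two closed paths are
equivalent if they differ only in the starting point, so a class is a list of oriented edges up to
cyclic rotation. -/
def PrimeClass (G : OrientedEdgeGraph V D) : Type _ :=
  {c : Cycle D // ∃ l : List D, (l : Cycle D) = c ∧
    G.IsClosedPath l ∧ G.IsBacktrackless l ∧ G.IsTailless l ∧ IsPrimitive l}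

/-- The factor `(1 - u ^ |C|)⁻¹` of the Ihara zeta function. -/
noncomputable def zetaFactor (G : OrientedEdgeGraph V D) (u : ℂ) (c : G.PrimeClass) : ℂ :=
  (1 - u ^ c.1.length)⁻¹

/-- The Ihara zeta function: the product of `(1 - u ^ |C|)⁻¹` over all equivalence classes of
primitive, backtrackless, tailless closed paths (for `|u|` small, where the product converges). -/
noncomputable def zeta (G : OrientedEdgeGraph V D) (u : ℂ) : ℂ :=
  ∏' c : G.PrimeClass, G.zetaFactor u c

end OrientedEdgeGraph

/-! Both sides of the equivalence are equivalent to one list of conditions on $H=G_2$ and $H'=G_2'$: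
the same number of vertices, the same number of edges, the same product of the two degrees, and the
same characteristic polynomial of the adjacency matrix.

Zeta side. Let $T$ be the matrix of the relation "$e$ may follow $d$ without backtracking". Summing
$u^{|l|}/|l|$ over all reduced closed paths, once by length and once by primitive root, gives
$Z_G(u)^{-1}=\det(1-uT)$ near $0$, so equality of zeta functions is equality of these polynomials
$f$, $f'$. Bass's formula (`bass`) expresses $f$ through $\det(1+u^2(D-1)-uA)$. For a join the
off-diagonal blocks have rank one, and the vector solving $Mx=1$ on each side is constant on the two
parts. The determinant is therefore the product of one block determinant per side, times
$1-u^2\frac{(\mu+2u\sigma)(\mu'+2u\sigma')}{\Delta\Delta'}$, where $\sigma,\sigma'$ count edges and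
$\mu,\mu',\Delta,\Delta'$ depend only on $u^2$ (`ihara_join`).

Bipartiteness makes the block determinants even in $u$, so the odd and even parts of $f$ separate
the last factor. From $f=f'$ the data are recovered in turn. The degree of $f$ is twice the number
of edges of the join. The order of vanishing at $u=1$ gives the number of vertices of $H$, because
strict diagonal dominance keeps all other factors nonzero there; the number of edges of $H$ follows.
The ratio of the even to the odd part, through leading coefficients, gives the product of the
degrees (`degree_prod_eq`). Everything except the block of $H$ then agrees, and that block is a
rescaled value of the characteristic polynomial of $H$ at infinitely many points
(`iharaBlock_eq_iff`). If the join has no odd part, neither factor has edges and only the numbers of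
vertices remain to be compared.

Spectral side. The same rank-one computation gives `charpoly_join`, and the same parity argument,
applied to polynomials in $x$, recovers the list. -/

namespace Matrix

/-! ### Determinants and traces through eigenvalues -/

open Polynomial

variable {n : Type*} [Fintype n] [DecidableEq n]

/-- Since `p` splits and the determinant is multiplicative, only `X - C c` matters. There the
determinant is the characteristic polynomial at `c` up to sign, and the sign is absorbed because the
number of roots is the size of the matrix. -/
theorem det_aeval_eq_prod_roots_charpoly {K : Type*} [Field K] [IsAlgClosed K]
    (M : Matrix n n K) (p : K[X]) :
    (aeval M p).det = (M.charpoly.roots.map fun x => p.eval x).prod := by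
  have hcard : M.charpoly.roots.card = Fintype.card n := by
    rw [← (IsAlgClosed.splits M.charpoly).natDegree_eq_card_roots, charpoly_natDegree_eq_dim]
  have hlin : ∀ c : K, (aeval M (X - C c)).det = (M.charpoly.roots.map fun x => x - c).prod := by
    intro c
    have h := eval_charpoly M c
    have h2 := (IsAlgClosed.splits M.charpoly).eq_prod_roots_of_monic M.charpoly_monic
    have h3 : (aeval M (X - C c)) = -(scalar n c - M) := by
      simp [Matrix.algebraMap_eq_diagonal, Matrix.scalar_apply]
    rw [h3, det_neg, ← h]
    conv_lhs => rw [h2]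
    rw [eval_multiset_prod, Multiset.map_map, ← hcard]
    have h4 : (M.charpoly.roots.map fun x => x - c)
        = (M.charpoly.roots.map fun x => eval c (X - C x)).map Neg.neg := by
      rw [Multiset.map_map]
      simp
    rw [h4, Multiset.prod_map_neg]
    simp
  have hp := (IsAlgClosed.splits p).eq_prod_roots
  suffices ∀ s : Multiset K, (aeval M (s.map fun a => X - C a).prod).det
      = (M.charpoly.roots.map fun x => ((s.map fun a => X - C a).prod).eval x).prod by
    rw [hp, map_mul, det_mul, this]
    simp [Multiset.prod_map_mul, hcard, Matrix.algebraMap_eq_diagonal, det_diagonal]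
  intro s
  induction s using Multiset.induction_on with
  | empty => simp
  | cons a s ih =>
    simp only [Multiset.map_cons, Multiset.prod_cons, map_mul, det_mul, eval_mul,
      Multiset.prod_map_mul]
    rw [ih, hlin]
    simp

theorem roots_charpoly_pow {K : Type*} [Field K] [IsAlgClosed K]
    (M : Matrix n n K) (k : ℕ) :
    (M ^ k).charpoly.roots = M.charpoly.roots.map (· ^ k) := by
  have hcard : M.charpoly.roots.card = Fintype.card n := by
    rw [← (IsAlgClosed.splits M.charpoly).natDegree_eq_card_roots, charpoly_natDegree_eq_dim]
  suffices (M ^ k).charpoly = ((M.charpoly.roots.map (· ^ k)).map fun a => X - C a).prod by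
    rw [this, roots_multiset_prod_X_sub_C]
  have : Infinite K := IsAlgClosed.instInfinite
  refine Polynomial.funext fun c => ?_
  have h := det_aeval_eq_prod_roots_charpoly M (C c - X ^ k)
  rw [eval_charpoly, eval_multiset_prod]
  simp only [map_sub, aeval_C, map_pow, aeval_X] at h
  simp only [Multiset.map_map]
  rw [Matrix.algebraMap_eq_diagonal] at h
  refine Eq.trans ?_ (h.trans ?_)
  · rfl
  · congr 1
    exact Multiset.map_congr rfl fun x _ => by simp

theorem trace_pow_eq_sum_roots {K : Type*} [Field K] [IsAlgClosed K]
    (M : Matrix n n K) (k : ℕ) :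
    (M ^ k).trace = (M.charpoly.roots.map (· ^ k)).sum := by
  rw [trace_eq_sum_roots_charpoly, roots_charpoly_pow]

theorem eval_charpolyRev_eq {R : Type*} [CommRing R] (M : Matrix n n R) (u : R) :
    M.charpolyRev.eval u = (1 - u • M).det := by
  rw [charpolyRev, ← coe_evalRingHom, RingHom.map_det]
  congr 1
  ext i j
  simp [Matrix.one_apply, apply_ite, mul_comm (M i j) u]

theorem det_one_sub_smul_eq_prod (M : Matrix n n ℂ) (u : ℂ) :
    (1 - u • M).det = (M.charpoly.roots.map fun x => 1 - u * x).prod := by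
  have h := det_aeval_eq_prod_roots_charpoly M (1 - C u * X)
  rw [map_sub, map_mul, aeval_C, aeval_X, map_one, ← Algebra.smul_def] at h
  rw [h]
  simp only [eval_sub, eval_mul, eval_one, eval_C, eval_X]

/-- The trace is the power sum of the eigenvalues, so the series is the sum of the Taylor series of
$-\log(1-u\lambda)$, convergent once all $|u\lambda|<1$. -/
theorem eventually_hasSum_trace_pow (M : Matrix n n ℂ) :
    ∀ᶠ u in 𝓝 (0 : ℂ), ∀ S : ℂ,
      HasSum (fun k : ℕ => (M ^ (k + 1)).trace * u ^ (k + 1) / (k + 1)) S →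
        Complex.exp S = ((1 - u • M).det)⁻¹ := by
  have hsmall : ∀ s : Multiset ℂ, ∀ᶠ u in 𝓝 (0 : ℂ), ∀ x ∈ s, ‖u * x‖ < 1 := by
    intro s
    induction s using Multiset.induction_on with
    | empty => simp
    | cons a s ih =>
      have : Tendsto (fun u : ℂ => ‖u * a‖) (𝓝 0) (𝓝 ‖(0 : ℂ) * a‖) :=
        (continuous_norm.comp (continuous_id.mul continuous_const)).tendsto 0
      rw [zero_mul, norm_zero] at this
      filter_upwards [ih, this.eventually (gt_mem_nhds one_pos)] with u h1 h2
      simp only [Multiset.mem_cons]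
      rintro x (rfl | hx)
      · exact h2
      · exact h1 x hx
  filter_upwards [hsmall M.charpoly.roots] with u hu S hS
  rw [det_one_sub_smul_eq_prod]
  suffices ∀ s : Multiset ℂ, (∀ x ∈ s, ‖u * x‖ < 1) → ∃ T,
      HasSum (fun k : ℕ => (s.map (· ^ (k + 1))).sum * u ^ (k + 1) / (k + 1)) T ∧
      Complex.exp T = ((s.map fun x => 1 - u * x).prod)⁻¹ by
    obtain ⟨T, hT, hexp⟩ := this _ hu
    simp only [trace_pow_eq_sum_roots] at hS
    rw [hS.unique hT, hexp]
  intro s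
  induction s using Multiset.induction_on with
  | empty => intro _; exact ⟨0, by simp, by simp⟩
  | cons a s ih =>
    intro h
    obtain ⟨T, hT, hexp⟩ := ih fun x hx => h x (Multiset.mem_cons_of_mem hx)
    have ha := h a (Multiset.mem_cons_self a s)
    refine ⟨-Complex.log (1 - u * a) + T, ?_, ?_⟩
    · refine ((Complex.hasSum_taylorSeries_neg_log' ha).add hT).congr_fun ?_
      intro k
      simp only [Multiset.map_cons, Multiset.sum_cons]
      ring
    · have hne : 1 - u * a ≠ 0 := by
        intro h0
        rw [← sub_eq_zero.mp h0] at ha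
        simp at ha
      rw [Complex.exp_add, hexp, Complex.exp_neg, Complex.exp_log hne]
      simp [mul_comm]

end Matrix

/-! ### Powers, rotations and periods of words -/

namespace List

variable {α : Type*}

theorem length_flatten_replicate (k : ℕ) (m : List α) :
    (replicate k m).flatten.length = k * m.length := by
  simp

theorem flatten_replicate_flatten_replicate (j k : ℕ) (m : List α) :
    (replicate j (replicate k m).flatten).flatten = (replicate (j * k) m).flatten := by
  induction j with
  | zero => simp
  | succ j ih =>
    rw [replicate_succ, flatten_cons, ih, Nat.succ_mul, Nat.add_comm, replicate_add, flatten_append]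

theorem flatten_replicate_append_comm (k : ℕ) (x y : List α) :
    (replicate k (x ++ y)).flatten ++ x = x ++ (replicate k (y ++ x)).flatten := by
  induction k with
  | zero => simp
  | succ k ih => simp [replicate_succ, ih]

theorem rotate_flatten_replicate (k : ℕ) (m : List α) {r : ℕ} (hr : r ≤ m.length) :
    (replicate k m).flatten.rotate r = (replicate k (m.rotate r)).flatten := by
  cases k with
  | zero => simp
  | succ k =>
    obtain ⟨x, y, rfl, rfl⟩ : ∃ x y, m = x ++ y ∧ r = x.length :=
      ⟨m.take r, m.drop r, (take_append_drop r m).symm, by simp [hr]⟩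
    rw [rotate_append_length_eq, replicate_succ, flatten_cons, append_assoc,
      rotate_append_length_eq, append_assoc, flatten_replicate_append_comm, replicate_succ,
      flatten_cons, append_assoc]

theorem flatten_replicate_succ_inj {j k : ℕ} {m m' : List α} (hl : m.length = m'.length)
    (h : (replicate (j + 1) m).flatten = (replicate (k + 1) m').flatten) : m = m' := by
  simp only [replicate_succ, flatten_cons] at h
  exact (append_inj h hl).1

/-- Commutation forces `x` to be a prefix of `y`, and the remainder again commutes with `x`; induct
on the length quotient. -/
theorem eq_flatten_replicate_of_append_comm (k : ℕ) (x y : List α) (h : y ++ x = x ++ y)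
    (hl : y.length = k * x.length) : y = (replicate k x).flatten := by
  induction k generalizing y with
  | zero => simpa using hl
  | succ k ih =>
    obtain ⟨z, rfl⟩ : x <+: y := by
      refine prefix_of_prefix_length_le (l₃ := y ++ x) ⟨y, h.symm⟩ (prefix_append _ _) ?_
      rw [hl]
      nlinarith
    rw [replicate_succ, flatten_cons, ← ih z]
    · simpa using h
    · simp only [length_append] at hl
      rw [Nat.succ_mul] at hl
      omega

/-- The least positive number of places by which `l` can be rotated without changing. -/
noncomputable def rotationPeriod (l : List α) : ℕ :=
  Function.minimalPeriod (fun l : List α => l.rotate 1) l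

theorem iterate_rotate_one (n : ℕ) (l : List α) :
    (fun l : List α => l.rotate 1)^[n] l = l.rotate n := by
  induction n with
  | zero => simp
  | succ n ih => rw [Function.iterate_succ_apply', ih, rotate_rotate]

theorem rotate_eq_self_iff_rotationPeriod_dvd {n : ℕ} {l : List α} :
    l.rotate n = l ↔ l.rotationPeriod ∣ n := by
  rw [rotationPeriod, ← Function.isPeriodicPt_iff_minimalPeriod_dvd, Function.IsPeriodicPt,
    Function.IsFixedPt, iterate_rotate_one]

theorem rotationPeriod_dvd_length (l : List α) : l.rotationPeriod ∣ l.length :=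
  rotate_eq_self_iff_rotationPeriod_dvd.mp (rotate_length l)

theorem rotationPeriod_le_length {l : List α} (h : l ≠ []) : l.rotationPeriod ≤ l.length :=
  Nat.le_of_dvd (length_pos_iff.mpr h) l.rotationPeriod_dvd_length

/-- A rotation of a power by at most `m.length` places rotates each copy of `m` by the same amount,
so it fixes the power exactly when it fixes `m`. -/
theorem rotationPeriod_flatten_replicate (k : ℕ) {m : List α} (hm : m ≠ []) :
    (replicate (k + 1) m).flatten.rotationPeriod = m.rotationPeriod := by
  have h1 : (replicate (k + 1) m).flatten.rotationPeriod ∣ m.rotationPeriod := by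
    rw [← rotate_eq_self_iff_rotationPeriod_dvd,
      rotate_flatten_replicate _ _ (rotationPeriod_le_length hm),
      rotate_eq_self_iff_rotationPeriod_dvd.mpr dvd_rfl]
  have hpos : 0 < m.rotationPeriod :=
    Nat.pos_of_dvd_of_pos m.rotationPeriod_dvd_length (length_pos_iff.mpr hm)
  refine Nat.dvd_antisymm h1 ?_
  rw [← rotate_eq_self_iff_rotationPeriod_dvd]
  refine flatten_replicate_succ_inj (j := k) (k := k) (by simp) ?_
  rw [← rotate_flatten_replicate _ _
    ((Nat.le_of_dvd hpos h1).trans (rotationPeriod_le_length hm))]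
  exact rotate_eq_self_iff_rotationPeriod_dvd.mpr dvd_rfl

end List

/-! ### Primitive words and primitive roots -/

namespace OrientedEdgeGraph

variable {D : Type*}

theorem IsPrimitive.ne_nil {m : List D} (h : IsPrimitive m) : m ≠ [] := by
  rintro rfl
  -- The empty word is its own square.
  exact h [] 2 le_rfl (by simp)

/-- If the period were a proper divisor of the length, the prefix of that length would commute with
the rest of the word, which would make the word a proper power. -/
theorem IsPrimitive.rotationPeriod_eq {m : List D} (h : IsPrimitive m) :
    m.rotationPeriod = m.length := by
  obtain ⟨k, hk⟩ := m.rotationPeriod_dvd_length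
  have hpos : 0 < m.length := List.length_pos_iff.mpr h.ne_nil
  rcases k with - | k
  · omega
  rcases k with - | k
  · omega
  exfalso
  set p := m.rotationPeriod with hp
  have hle : p ≤ m.length := List.rotationPeriod_le_length h.ne_nil
  have hrot : m.rotate p = m := List.rotate_eq_self_iff_rotationPeriod_dvd.mpr dvd_rfl
  refine h (m.take p) (k + 2) (by omega) ?_
  rw [List.replicate_succ, List.flatten_cons,
    ← List.eq_flatten_replicate_of_append_comm (k + 1) (m.take p) (m.drop p), List.take_append_drop]
  · rw [← List.rotate_eq_drop_append_take hle, hrot, List.take_append_drop]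
  · rw [List.length_drop, List.length_take, min_eq_left hle, hk, Nat.sub_eq_iff_eq_add' (by nlinarith)]
    ring

theorem IsPrimitive.rotate {m : List D} (h : IsPrimitive m) (r : ℕ) : IsPrimitive (m.rotate r) := by
  intro w k hk hw
  obtain ⟨s, hs⟩ := (show m ~r m.rotate r from ⟨r, rfl⟩).symm
  rcases eq_or_ne w [] with rfl | hne
  · exact h.ne_nil (by simpa using hw)
  refine h (w.rotate (s % w.length)) k hk ?_
  have hdiv := Nat.mod_add_div s w.length
  have hw' : ((List.replicate k w).flatten).rotate (w.length) = (List.replicate k w).flatten := by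
    rw [List.rotate_flatten_replicate _ _ le_rfl, List.rotate_length]
  rw [← List.rotate_flatten_replicate _ _ (Nat.mod_lt _ (List.length_pos_iff.mpr hne)).le, ← hs, hw]
  conv_lhs => rw [← hdiv, Nat.add_comm, ← List.rotate_rotate]
  rw [List.rotate_eq_self_iff_rotationPeriod_dvd.mpr
    ((List.rotate_eq_self_iff_rotationPeriod_dvd.mp hw').mul_right _)]

theorem exists_isPrimitive_flatten_replicate (l : List D) (hl : l ≠ []) :
    ∃ m k, IsPrimitive m ∧ (List.replicate (k + 1) m).flatten = l := by
  induction hn : l.length using Nat.strong_induction_on generalizing l with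
  | _ n ih =>
  by_cases h : IsPrimitive l
  · exact ⟨l, 0, h, by simp⟩
  · simp only [IsPrimitive, not_forall, not_not] at h
    obtain ⟨w, k, hk, rfl⟩ := h
    have hw : w ≠ [] := by
      rintro rfl
      simp at hl
    have hwpos := List.length_pos_iff.mpr hw
    have hlt : w.length < n := by
      rw [← hn, List.length_flatten_replicate]
      nlinarith
    obtain ⟨m, j, hm, rfl⟩ := ih _ hlt w hw rfl
    refine ⟨m, k * (j + 1) - 1, hm, ?_⟩
    rw [List.flatten_replicate_flatten_replicate, Nat.sub_add_cancel]
    nlinarith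

/-- Uniqueness of the primitive root: its length is the rotation period of the power, and a prefix
is determined by its length. -/
theorem IsPrimitive.flatten_replicate_inj {m m' : List D} {j k : ℕ} (hm : IsPrimitive m)
    (hm' : IsPrimitive m')
    (h : (List.replicate (j + 1) m).flatten = (List.replicate (k + 1) m').flatten) :
    m = m' ∧ j = k := by
  have hl : m.length = m'.length := by
    rw [← hm.rotationPeriod_eq, ← hm'.rotationPeriod_eq,
      ← List.rotationPeriod_flatten_replicate j hm.ne_nil, h,
      List.rotationPeriod_flatten_replicate k hm'.ne_nil]
  refine ⟨List.flatten_replicate_succ_inj hl h, ?_⟩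
  have := congrArg List.length h
  rw [List.length_flatten_replicate, List.length_flatten_replicate, hl] at this
  have := Nat.eq_of_mul_eq_mul_right (List.length_pos_iff.mpr hm'.ne_nil) this
  omega

/-- The rotations by fewer places than the period are distinct, and a primitive word has full
period. This count cancels the weight $1/|m|$ in the logarithm of the Euler product. -/
theorem IsPrimitive.ncard_rotations {m : List D} (hm : IsPrimitive m) :
    Set.ncard {l : List D | (l : Cycle D) = m} = m.length := by
  have : {l : List D | (l : Cycle D) = m} = (fun r => m.rotate r) '' Set.Iio m.length := by
    ext l
    simp only [Set.mem_ofPred_eq, Set.mem_image, Set.mem_Iio, Cycle.coe_eq_coe]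
    constructor
    · intro h
      obtain ⟨n, rfl⟩ := h.symm
      exact ⟨n % m.length, Nat.mod_lt _ (List.length_pos_iff.mpr hm.ne_nil), List.rotate_mod _ _⟩
    · rintro ⟨r, -, rfl⟩
      exact List.IsRotated.forall _ _
  rw [this, Set.InjOn.ncard_image, Set.ncard_eq_toFinset_card']
  · simp
  · have h := Function.iterate_injOn_Iio_minimalPeriod (f := fun l : List D => l.rotate 1) (x := m)
    simp only [List.iterate_rotate_one] at h
    rwa [← hm.rotationPeriod_eq]

end OrientedEdgeGraph

/-! ### Closed walks and traces of powers -/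

namespace Matrix

/-- The `0`-`1` matrix of a relation. -/
noncomputable def ofRel {D : Type*} (R : D → D → Prop) : Matrix D D ℂ :=
  open Classical in Matrix.of fun d e => if R d e then 1 else 0

open Classical in
theorem ofRel_pow_apply {D : Type*} [Fintype D] [DecidableEq D] (R : D → D → Prop) (k : ℕ) (a b : D) :
    (ofRel R ^ (k + 1)) a b
      = ∑ f : Fin k → D, if List.IsChain R (a :: (List.ofFn f ++ [b])) then (1 : ℂ) else 0 := by
  induction k generalizing a with
  | zero => simp [ofRel]
  | succ k ih =>
    rw [pow_succ', mul_apply, ← (Fin.consEquiv fun _ => D).sum_comp, Fintype.sum_prod_type]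
    refine Finset.sum_congr rfl fun c _ => ?_
    rw [ih]
    by_cases h : R a c <;> simp [ofRel, Fin.consEquiv, List.ofFn_succ, h]

open Classical in
-- A diagonal entry of the power counts closed walks from its index. `Cycle.Chain` includes the
-- wrap-around condition, which is the last step of the walk.
theorem trace_ofRel_pow {D : Type*} [Fintype D] [DecidableEq D] (R : D → D → Prop) (k : ℕ) :
    (ofRel R ^ (k + 1)).trace
      = Nat.card {l : List D // l.length = k + 1 ∧ Cycle.Chain R l} := by
  have e : {l : List D // l.length = k + 1 ∧ Cycle.Chain R l}
      ≃ {f : Fin (k + 1) → D // Cycle.Chain R (List.ofFn f : List D)} :=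
    { toFun := fun l => ⟨fun i => l.1[i]'(by rw [l.2.1]; exact i.2), by
        have : List.ofFn (fun i : Fin (k + 1) => l.1[i]'(by rw [l.2.1]; exact i.2)) = l.1 :=
          List.ext_getElem (by simp [l.2.1]) (by simp [-List.ofFn_succ])
        rw [this]
        exact l.2.2⟩
      invFun := fun f => ⟨List.ofFn f.1, by simp, f.2⟩
      left_inv := fun l => Subtype.ext (List.ext_getElem (by simp [l.2.1]) (by simp [-List.ofFn_succ]))
      right_inv := fun f => Subtype.ext (by ext i; simp [-List.ofFn_succ]) }
  rw [Nat.card_congr e, Nat.card_eq_fintype_card, Fintype.card_subtype, Finset.card_filter,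
    ← (Fin.consEquiv fun _ => D).sum_comp, Fintype.sum_prod_type, Matrix.trace]
  push_cast
  refine Finset.sum_congr rfl fun a _ => ?_
  rw [Matrix.diag_apply, ofRel_pow_apply]
  simp [Fin.consEquiv, List.ofFn_succ]

end Matrix

namespace Cycle

variable {D : Type*} {R : D → D → Prop}

theorem chain_flatten_replicate (k : ℕ) (m : List D) :
    Cycle.Chain R ((List.replicate (k + 1) m).flatten : List D) ↔ Cycle.Chain R m := by
  cases m with
  | nil => simp
  | cons a t =>
    suffices ∀ k, List.IsChain R ((List.replicate (k + 1) (a :: t)).flatten ++ [a]) ↔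
        List.IsChain R (a :: t ++ [a]) from by
      simpa [List.replicate_succ] using this k
    intro k
    induction k with
    | zero => simp
    | succ k ih =>
      rw [List.replicate_succ, List.flatten_cons]
      rw [List.replicate_succ, List.flatten_cons] at ih ⊢
      simp only [List.cons_append, List.append_assoc] at ih ⊢
      rw [← List.cons_append, List.isChain_split, List.cons_append, ih, and_self]

end Cycle

/-! ### The logarithm of the Euler product -/

section Summation

variable {D : Type*}

theorem summable_pow_length [Fintype D] {r : ℝ} (hr : 0 ≤ r) (h : Fintype.card D * r < 1) :
    Summable fun l : List D => r ^ l.length := by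
  rw [← List.equivSigmaTuple.symm.summable_iff, summable_sigma_of_nonneg]
  · refine ⟨fun n => Summable.of_finite, ?_⟩
    have : Summable fun n : ℕ => (Fintype.card D * r) ^ n :=
      summable_geometric_of_lt_one (by positivity) h
    refine this.congr fun n => ?_
    simp [List.equivSigmaTuple, mul_pow]
  · intro x
    exact pow_nonneg hr _

/-- The logarithm of the Euler product over the prime cycles of a relation. -/
theorem exists_hasSum_prime_log [Fintype D] [DecidableEq D] (R : D → D → Prop) {u : ℂ}
    (hu1 : ‖u‖ < 1) (hu : Fintype.card D * ‖u‖ < 1) :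
    ∃ S : ℂ, HasSum (fun k : ℕ => (Matrix.ofRel R ^ (k + 1)).trace * u ^ (k + 1) / (k + 1)) S ∧
      HasSum (fun c : {c : Cycle D // ∃ l : List D, (l : Cycle D) = c ∧ (l ≠ [] ∧ Cycle.Chain R l)
        ∧ OrientedEdgeGraph.IsPrimitive l} => -Complex.log (1 - u ^ c.1.length)) S := by
  let L := {l : List D // l ≠ [] ∧ Cycle.Chain R l}
  let P := {m : List D // (m ≠ [] ∧ Cycle.Chain R m) ∧ OrientedEdgeGraph.IsPrimitive m}
  let F : L → ℂ := fun l => u ^ l.1.length / l.1.length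
  have hF : Summable F := by
    refine Summable.of_norm_bounded ((summable_pow_length (norm_nonneg u) hu).subtype _) fun l => ?_
    have : (1 : ℝ) ≤ l.1.length := by exact_mod_cast List.length_pos_iff.mpr l.2.1
    simp only [F, norm_div, norm_pow, Complex.norm_natCast, Function.comp_def]
    exact div_le_self (by positivity) this
  -- The absolutely convergent sum of $u^{|l|}/|l|$ over closed chains is now evaluated in two ways:
  -- by length, then by primitive root and rotation class.
  refine ⟨∑' l, F l, ?_, ?_⟩
  · refine (hF.hasSum.tsum_fiberwise fun l : L => l.1.length - 1).congr_fun fun k => ?_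
    have hlen : ∀ l : (fun l : L => l.1.length - 1) ⁻¹' {k}, l.1.1.length = k + 1 := by
      intro l
      have h1 := List.length_pos_iff.mpr l.1.2.1
      have h2 : l.1.1.length - 1 = k := l.2
      omega
    have e : {l : List D // l.length = k + 1 ∧ Cycle.Chain R l}
        ≃ ((fun l : L => l.1.length - 1) ⁻¹' {k}) :=
      { toFun := fun l => ⟨⟨l.1, List.length_pos_iff.mp (by rw [l.2.1]; omega), l.2.2⟩, by
          simp [l.2.1]⟩
        invFun := fun l => ⟨l.1.1, hlen l, l.1.2.2⟩
        left_inv := fun l => rfl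
        right_inv := fun l => rfl }
    rw [tsum_congr (g := fun _ => u ^ (k + 1) / ((k + 1 : ℕ) : ℂ)) fun l => by
      simp only [F]; rw [hlen l], tsum_const, Matrix.trace_ofRel_pow, Nat.card_congr e]
    simp [mul_div_assoc]
  -- Every closed chain is uniquely a power of a primitive one. Summing over the exponents gives a
  -- logarithm divided by the length of the root.
  · let E : P × ℕ → L := fun x => ⟨(List.replicate (x.2 + 1) x.1.1).flatten, by
      have := x.1.2.2.ne_nil
      simpa using this, (Cycle.chain_flatten_replicate _ _).mpr x.1.2.1.2⟩
    have hE : Function.Bijective E := by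
      constructor
      · rintro ⟨m, j⟩ ⟨m', k⟩ h
        obtain ⟨h1, h2⟩ := m.2.2.flatten_replicate_inj m'.2.2 (congrArg Subtype.val h)
        exact Prod.ext (Subtype.ext h1) h2
      · rintro ⟨l, hl, hc⟩
        obtain ⟨m, k, hm, rfl⟩ := OrientedEdgeGraph.exists_isPrimitive_flatten_replicate l hl
        exact ⟨(⟨m, ⟨hm.ne_nil, (Cycle.chain_flatten_replicate _ _).mp hc⟩, hm⟩, k), rfl⟩
    have hsum := ((Equiv.ofBijective E hE).hasSum_iff (f := F)).mpr hF.hasSum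
    have hP : HasSum (fun m : P => -Complex.log (1 - u ^ m.1.length) / m.1.length) (∑' l, F l) := by
      refine hsum.prod_fiberwise fun m => ?_
      have hpos := List.length_pos_iff.mpr m.2.2.ne_nil
      have : ‖u ^ m.1.length‖ < 1 := by
        rw [norm_pow]
        exact pow_lt_one₀ (norm_nonneg u) hu1 hpos.ne'
      refine ((Complex.hasSum_taylorSeries_neg_log' this).div_const (m.1.length : ℂ)).congr_fun ?_
      intro j
      simp only [F, E, Function.comp_apply, Equiv.ofBijective_apply, List.length_flatten_replicate]
      push_cast
      rw [← pow_mul, div_div, mul_comm m.1.length]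
    let g : P → {c : Cycle D // ∃ l : List D, (l : Cycle D) = c ∧ (l ≠ [] ∧ Cycle.Chain R l)
        ∧ OrientedEdgeGraph.IsPrimitive l} := fun m => ⟨m.1, m.1, rfl, m.2⟩
    -- Each class contains as many primitive lists as its length, all with equal terms, which
    -- removes the remaining denominator.
    refine (hP.tsum_fiberwise g).congr_fun fun c => ?_
    obtain ⟨c, l, rfl, hl, hprim⟩ := c
    have hfib : ∀ m : List D, (m : Cycle D) = l →
        (m ≠ [] ∧ Cycle.Chain R m) ∧ OrientedEdgeGraph.IsPrimitive m := by
      intro m hm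
      obtain ⟨r, rfl⟩ := (Cycle.coe_eq_coe.mp hm).symm
      exact ⟨⟨by simpa using hl.1, by rw [hm]; exact hl.2⟩, hprim.rotate r⟩
    have e : {m : List D | (m : Cycle D) = l} ≃ (g ⁻¹' {⟨l, l, rfl, hl, hprim⟩}) :=
      { toFun := fun m => ⟨⟨m.1, hfib m.1 m.2⟩, Subtype.ext m.2⟩
        invFun := fun m => ⟨m.1.1, congrArg Subtype.val m.2⟩
        left_inv := fun m => rfl
        right_inv := fun m => rfl }
    have hlen : ∀ m : (g ⁻¹' {⟨l, l, rfl, hl, hprim⟩}), m.1.1.length = l.length := fun m =>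
      (Cycle.coe_eq_coe.mp (congrArg Subtype.val m.2)).perm.length_eq
    rw [tsum_congr (g := fun _ => -Complex.log (1 - u ^ l.length) / (l.length : ℂ)) fun m => by
      rw [hlen m], tsum_const, ← Nat.card_congr e, Nat.card_coe_set_eq, hprim.ncard_rotations]
    have : (l.length : ℂ) ≠ 0 := by exact_mod_cast (List.length_pos_iff.mpr hl.1).ne'
    rw [nsmul_eq_mul, mul_div_cancel₀ _ this]
    simp

end Summation

/-! ### The zeta function as the reciprocal of a determinant -/

namespace OrientedEdgeGraph

variable {V D : Type*}

/-- One oriented edge may follow another one in a path without backtracking. -/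
def Follows (G : OrientedEdgeGraph V D) (d e : D) : Prop :=
  G.tgt d = G.src e ∧ e ≠ G.inv d

/-- Closing up and taillessness are the conditions of a path and of no backtracking at the
wrap-around, so a single cyclic chain condition encodes all three. -/
theorem reduced_closed_iff (G : OrientedEdgeGraph V D) (l : List D) :
    (G.IsClosedPath l ∧ G.IsBacktrackless l ∧ G.IsTailless l) ↔
      (l ≠ [] ∧ Cycle.Chain G.Follows l) := by
  cases l with
  | nil => simp [IsClosedPath]
  | cons a t =>
    have hinv : ∀ d, d ≠ G.inv a ↔ a ≠ G.inv d := fun d =>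
      not_congr ⟨fun h => by rw [h, G.inv_inv], fun h => by rw [h, G.inv_inv]⟩
    have hand : ∀ l : List D, l.IsChain G.Follows ↔
        l.IsChain (fun d e => G.tgt d = G.src e) ∧ l.IsChain (fun d e => e ≠ G.inv d) := by
      intro l
      induction l with
      | nil => simp
      | cons a t ih =>
        cases t with
        | nil => simp
        | cons b t =>
          simp only [List.isChain_cons_cons, ih, Follows]
          tauto
    rw [Cycle.chain_coe_cons, ← List.cons_append, List.isChain_append, hand]
    simp only [IsClosedPath, IsBacktrackless, IsTailless, Follows, hinv, List.head_cons, ne_eq,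
      reduceCtorEq, not_false_eq_true, exists_true_left, forall_true_left, List.isChain_singleton,
      List.getLast?_eq_getLast_of_ne_nil (List.cons_ne_nil a t), List.head?_cons, true_and,
      Option.mem_def, Option.some.injEq, forall_eq']
    tauto

/-- Hashimoto's determinant formula for the Ihara zeta function. -/
theorem eventually_hasProd_zetaFactor [Fintype D] [DecidableEq D] (G : OrientedEdgeGraph V D) :
    ∀ᶠ u in 𝓝 (0 : ℂ), HasProd (G.zetaFactor u) ((1 - u • Matrix.ofRel G.Follows).det)⁻¹ := by
  have hsmall : ∀ C : ℝ, ∀ᶠ u in 𝓝 (0 : ℂ), C * ‖u‖ < 1 := by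
    intro C
    have : Tendsto (fun u : ℂ => C * ‖u‖) (𝓝 0) (𝓝 (C * ‖(0 : ℂ)‖)) :=
      (continuous_const.mul continuous_norm).tendsto 0
    rw [norm_zero, mul_zero] at this
    exact this.eventually (gt_mem_nhds one_pos)
  filter_upwards [hsmall 1, hsmall (Fintype.card D),
    Matrix.eventually_hasSum_trace_pow (Matrix.ofRel G.Follows)] with u h1 h2 h3
  rw [one_mul] at h1
  obtain ⟨S, hS, hprod⟩ := exists_hasSum_prime_log G.Follows h1 h2
  rw [← h3 S hS]
  let e : G.PrimeClass ≃ {c : Cycle D // ∃ l : List D, (l : Cycle D) = c ∧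
      (l ≠ [] ∧ Cycle.Chain G.Follows l) ∧ IsPrimitive l} :=
    Equiv.subtypeEquivRight fun c => exists_congr fun l => by
      rw [← reduced_closed_iff]
      tauto
  refine ((e.hasSum_iff.mpr hprod).cexp).congr_fun ?_
  intro c
  obtain ⟨l, hl, hc, -⟩ := c.2
  have hlen : c.1.length ≠ 0 := by
    rw [← hl, Cycle.length_coe]
    exact (List.length_pos_iff.mpr hc.2.1).ne'
  have hne : 1 - u ^ c.1.length ≠ 0 := by
    intro h0
    have : ‖u ^ c.1.length‖ < 1 := by
      rw [norm_pow]
      exact pow_lt_one₀ (norm_nonneg u) h1 hlen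
    rw [← sub_eq_zero.mp h0] at this
    simp at this
  have he : (e c).1 = c.1 := rfl
  simp only [Function.comp_apply, zetaFactor, he]
  rw [Complex.exp_neg, Complex.exp_log hne]

end OrientedEdgeGraph

namespace Matrix

theorem natDegree_charpolyRev_of_det_ne_zero {n K : Type*} [Fintype n] [DecidableEq n] [Field K]
    (M : Matrix n n K) (h : M.det ≠ 0) : M.charpolyRev.natDegree = Fintype.card n := by
  have h0 : M.charpoly.coeff 0 ≠ 0 := by
    intro h0
    rw [det_eq_sign_charpoly_coeff, h0, mul_zero] at h
    exact h rfl
  rw [← reverse_charpoly, Polynomial.reverse_natDegree, charpoly_natDegree_eq_dim,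
    Polynomial.natTrailingDegree_eq_zero.mpr (Or.inr h0), Nat.sub_zero]

end Matrix

/-! ### Bass's formula and the degree of the zeta polynomial -/

namespace OrientedEdgeGraph

open Matrix

variable {V D : Type*}

/-- The incidence matrix of vertices and oriented edges starting there. -/
def startMatrix [DecidableEq V] (G : OrientedEdgeGraph V D) : Matrix V D ℂ :=
  Matrix.of fun v d => if G.src d = v then 1 else 0

/-- The permutation matrix of the reversal of oriented edges. -/
def reverseMatrix [DecidableEq D] (G : OrientedEdgeGraph V D) : Matrix D D ℂ :=
  Matrix.of fun d e => if e = G.inv d then 1 else 0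

theorem eq_inv_comm (G : OrientedEdgeGraph V D) {d e : D} : e = G.inv d ↔ d = G.inv e :=
  ⟨fun h => by rw [h, G.inv_inv], fun h => by rw [h, G.inv_inv]⟩

variable [Fintype D]

section

variable [DecidableEq D]

theorem reverseMatrix_mul_self (G : OrientedEdgeGraph V D) :
    G.reverseMatrix * G.reverseMatrix = 1 := by
  ext d e
  have h : ∀ j, e = G.inv j ↔ j = G.inv e := fun j => G.eq_inv_comm
  simp only [reverseMatrix, Matrix.mul_apply, Matrix.one_apply, Matrix.of_apply, h, mul_ite, mul_one,
    mul_zero, Finset.sum_ite_eq', Finset.mem_univ, if_true]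
  congr 1
  exact propext ⟨fun h => by rw [← G.inv_inv d, ← h, G.inv_inv], fun h => by rw [h]⟩

/-- With $J$ the reversal matrix, $(1-uJ)(1+uJ)=(1-u^2)I$ and the two factors have the same
determinant. This determines the square of the polynomial, and its value at $0$ fixes the sign. -/
theorem det_one_sub_smul_reverseMatrix (G : OrientedEdgeGraph V D) {m : ℕ}
    (hm : Fintype.card D = 2 * m) (u : ℂ) :
    (1 - u • G.reverseMatrix).det = (1 - u ^ 2) ^ m := by
  have hmul : ∀ u : ℂ, (1 - u • G.reverseMatrix) * (1 + u • G.reverseMatrix)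
      = (1 - u ^ 2) • (1 : Matrix D D ℂ) := by
    intro u
    rw [Matrix.sub_mul, Matrix.one_mul, Matrix.mul_add, Matrix.mul_one, Matrix.smul_mul,
      Matrix.mul_smul, reverseMatrix_mul_self, smul_smul, sub_smul, one_smul, pow_two]
    abel
  have hflip : ∀ u : ℂ, (1 + u • G.reverseMatrix).det = (1 - u • G.reverseMatrix).det := by
    intro u
    let o := Fintype.equivFin D
    -- An arbitrary ordering singles out one orientation of each edge. The resulting signs change
    -- under reversal, so conjugation by them turns $J$ into $-J$.
    let ε : D → ℂ := fun d => if o d < o (G.inv d) then 1 else -1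
    have hε : ∀ d, ε d * ε d = 1 := fun d => by simp only [ε]; split_ifs <;> norm_num
    have hεinv : ∀ d, ε (G.inv d) = -ε d := by
      intro d
      have hne : o (G.inv d) ≠ o d := fun h => G.inv_ne d (o.injective h)
      simp only [ε, G.inv_inv]
      rcases lt_or_gt_of_ne hne with h | h
      · simp [h, h.not_gt]
      · simp [h, h.not_gt]
    have hconj : Matrix.diagonal ε * (1 + u • G.reverseMatrix) * Matrix.diagonal ε
        = 1 - u • G.reverseMatrix := by
      ext d e
      rw [Matrix.mul_diagonal, Matrix.diagonal_mul]
      simp only [Matrix.add_apply, Matrix.sub_apply, Matrix.smul_apply, reverseMatrix,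
        Matrix.of_apply, Matrix.one_apply, smul_eq_mul]
      by_cases h1 : d = e
      · subst h1
        have : d ≠ G.inv d := fun h => G.inv_ne d h.symm
        simp [this, hε]
      · by_cases h2 : e = G.inv d
        · subst h2
          simp only [h1, if_false, if_true, hεinv]
          linear_combination (-u) * hε d
        · simp [h1, h2]
    have hdet : (Matrix.diagonal ε).det * (Matrix.diagonal ε).det = 1 := by
      rw [← Matrix.det_mul, Matrix.diagonal_mul_diagonal]
      simp [hε]
    rw [← hconj, Matrix.det_mul, Matrix.det_mul]
    linear_combination (-(1 + u • G.reverseMatrix).det) * hdet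
  have hsq : G.reverseMatrix.charpolyRev ^ 2
      = ((1 - Polynomial.X ^ 2 : Polynomial ℂ) ^ m) ^ 2 := by
    refine Polynomial.funext fun c => ?_
    have h := congrArg Matrix.det (hmul c)
    rw [Matrix.det_mul, hflip, Matrix.det_smul, Matrix.det_one, hm, mul_one] at h
    simp only [Polynomial.eval_pow, eval_charpolyRev_eq, Polynomial.eval_sub, Polynomial.eval_one,
      Polynomial.eval_X]
    rw [sq, h, ← pow_mul, mul_comm]
  rcases sq_eq_sq_iff_eq_or_eq_neg.mp hsq with h | h
  · rw [← eval_charpolyRev_eq, h]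
    simp
  · have := congrArg (Polynomial.eval 0) h
    simp at this
    norm_num at this

end

variable [DecidableEq V]

theorem startMatrix_mul_transpose (G : OrientedEdgeGraph V D) :
    G.startMatrix * G.startMatrixᵀ = Matrix.diagonal fun v => (G.degree v : ℂ) := by
  ext v w
  simp only [startMatrix, Matrix.mul_apply, Matrix.transpose_apply, Matrix.of_apply, ← ite_and,
    mul_ite, mul_one, mul_zero, Finset.sum_boole, Matrix.diagonal_apply, degree]
  split_ifs with h
  · subst h
    simp [Nat.card_eq_fintype_card, Fintype.card_subtype]
  · rw [Finset.filter_false_of_mem]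
    · simp
    · rintro d - ⟨rfl, h'⟩
      exact h h'.symm

variable [DecidableEq D]

theorem startMatrix_mul_reverseMatrix_mul_transpose (G : OrientedEdgeGraph V D) :
    G.startMatrix * G.reverseMatrix * G.startMatrixᵀ = G.adjMatrix := by
  have : G.startMatrix * G.reverseMatrix = Matrix.of fun v d => if G.tgt d = v then 1 else 0 := by
    ext v d
    have h : ∀ j, d = G.inv j ↔ j = G.inv d := fun j => G.eq_inv_comm
    simp only [startMatrix, reverseMatrix, Matrix.mul_apply, Matrix.of_apply, h, mul_ite, mul_one,
      mul_zero, Finset.sum_ite_eq', Finset.mem_univ, if_true]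
    rfl
  rw [this]
  ext v w
  have hcard : Nat.card {d : D // G.src d = v ∧ G.tgt d = w}
      = Nat.card {d : D // G.tgt d = v ∧ G.src d = w} :=
    Nat.card_congr ⟨fun d => ⟨G.inv d.1, by simpa [tgt, G.inv_inv] using d.2⟩,
      fun d => ⟨G.inv d.1, by simpa [tgt, G.inv_inv] using d.2⟩,
      fun d => Subtype.ext (G.inv_inv _), fun d => Subtype.ext (G.inv_inv _)⟩
  simp only [startMatrix, Matrix.mul_apply, Matrix.transpose_apply, Matrix.of_apply, ← ite_and,
    mul_ite, mul_one, mul_zero, Finset.sum_boole, adjMatrix, hcard]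
  rw [Nat.card_eq_fintype_card, Fintype.card_subtype]
  simp only [and_comm]

variable [Fintype V]

theorem ofRel_follows (G : OrientedEdgeGraph V D) :
    Matrix.ofRel G.Follows
      = G.reverseMatrix * G.startMatrixᵀ * G.startMatrix - G.reverseMatrix := by
  have : G.reverseMatrix * G.startMatrixᵀ
      = Matrix.of fun d v => if G.tgt d = v then 1 else 0 := by
    ext d v
    simp only [startMatrix, reverseMatrix, Matrix.mul_apply, Matrix.of_apply, Matrix.transpose_apply,
      ite_mul, one_mul, zero_mul, Finset.sum_ite_eq', Finset.mem_univ, if_true]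
    rfl
  rw [this]
  ext d e
  simp only [Matrix.ofRel, Follows, startMatrix, reverseMatrix, Matrix.mul_apply, Matrix.of_apply,
    Matrix.sub_apply, mul_ite, mul_one, mul_zero, Finset.sum_ite_eq, Finset.mem_univ, if_true]
  by_cases h : e = G.inv d
  · subst h
    simp [tgt]
  · simp [h]

/-- Multiplying by the reversal matrix and exchanging the factors $JS^{\mathsf T}$ and $SJ$ reduces
the determinant, up to sign, to $\prod_v(1-\deg v)$. -/
theorem det_ofRel_follows_ne_zero (G : OrientedEdgeGraph V D) (h : ∀ v, G.degree v ≠ 1) :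
    (Matrix.ofRel G.Follows).det ≠ 0 := by
  intro h0
  have h1 : Matrix.ofRel G.Follows * G.reverseMatrix
      = -(1 - (G.reverseMatrix * G.startMatrixᵀ) * (G.startMatrix * G.reverseMatrix)) := by
    rw [ofRel_follows, Matrix.sub_mul, reverseMatrix_mul_self, neg_sub, Matrix.mul_assoc,
      Matrix.mul_assoc]
  have h2 := congrArg Matrix.det h1
  rw [Matrix.det_mul, h0, zero_mul, Matrix.det_neg, Matrix.det_one_sub_mul_comm,
    Matrix.mul_assoc, ← Matrix.mul_assoc G.reverseMatrix, reverseMatrix_mul_self, Matrix.one_mul,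
    startMatrix_mul_transpose, ← Matrix.diagonal_one, Matrix.diagonal_sub, Matrix.det_diagonal,
    eq_comm, mul_eq_zero, Finset.prod_eq_zero_iff] at h2
  rcases h2 with h2 | ⟨v, -, h2⟩
  · exact pow_ne_zero _ (neg_ne_zero.mpr one_ne_zero) h2
  · exact h v (by exact_mod_cast (sub_eq_zero.mp h2).symm)

/-- Bass's determinant formula. -/
theorem bass (G : OrientedEdgeGraph V D) {m : ℕ} (hm : Fintype.card D = 2 * m) {u : ℂ}
    (hu : 1 - u ^ 2 ≠ 0) :
    (1 - u ^ 2) ^ Fintype.card V * (1 - u • Matrix.ofRel G.Follows).det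
      = (1 - u ^ 2) ^ m * ((Matrix.diagonal fun v => 1 + u ^ 2 * ((G.degree v : ℂ) - 1))
          - u • G.adjMatrix).det := by
  set c := 1 - u ^ 2 with hc
  set J := G.reverseMatrix with hJ
  set S := G.startMatrix with hS
  have hJJ : J * J = 1 := G.reverseMatrix_mul_self
  -- The factor $1-uJ$ is chosen so that the product is a scalar matrix minus a product through the
  -- vertex space; exchanging the two factors then yields a determinant over vertices.
  have h1 : (1 - u • J) * (1 - u • Matrix.ofRel G.Follows)
      = c • (1 - ((u / c) • (J * Sᵀ - u • Sᵀ)) * S) := by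
    rw [ofRel_follows, ← hJ, ← hS, smul_sub c, Matrix.smul_mul (u / c), smul_smul c,
      mul_div_cancel₀ _ hu]
    simp only [Matrix.sub_mul, Matrix.mul_sub, Matrix.one_mul, Matrix.mul_one, Matrix.smul_mul,
      Matrix.mul_smul, ← Matrix.mul_assoc, hJJ, smul_sub, smul_smul]
    rw [hc, sub_smul, one_smul, pow_two]
    abel
  have h2 : c • (1 - S * ((u / c) • (J * Sᵀ - u • Sᵀ)))
      = (Matrix.diagonal fun v => 1 + u ^ 2 * ((G.degree v : ℂ) - 1)) - u • G.adjMatrix := by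
    rw [Matrix.mul_smul, smul_sub, smul_smul, mul_div_cancel₀ _ hu, Matrix.mul_sub,
      Matrix.mul_smul, ← Matrix.mul_assoc, startMatrix_mul_reverseMatrix_mul_transpose,
      startMatrix_mul_transpose, smul_sub, smul_smul]
    ext v w
    simp only [Matrix.sub_apply, Matrix.smul_apply, Matrix.one_apply, Matrix.diagonal_apply,
      smul_eq_mul, hc]
    split_ifs <;> ring
  have h3 := congrArg Matrix.det h1
  have h4 := congrArg Matrix.det h2
  rw [Matrix.det_smul] at h3 h4
  rw [Matrix.det_mul, Matrix.det_one_sub_mul_comm, G.det_one_sub_smul_reverseMatrix hm, ← hc,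
    hm] at h3
  rw [← h4]
  have hcm : c ^ m ≠ 0 := pow_ne_zero _ hu
  refine mul_left_cancel₀ hcm ?_
  linear_combination c ^ Fintype.card V * h3

end OrientedEdgeGraph

/-- The function equal to `a` on `S` and to `b` off `S`. -/
def Finset.twoValued {V R : Type*} [DecidableEq V] (S : Finset V) (a b : R) (v : V) : R :=
  if v ∈ S then a else b

namespace Finset

variable {V : Type*} [Fintype V] [DecidableEq V]

theorem sum_twoValued (S : Finset V) (a b : ℂ) :
    ∑ v, S.twoValued a b v = S.card * a + Sᶜ.card * b := by
  rw [← Finset.sum_add_sum_compl S,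
    Finset.sum_congr rfl (g := fun _ => a) fun v hv => by simp [twoValued, hv],
    Finset.sum_congr (s₁ := Sᶜ) rfl (g := fun _ => b) fun v hv => by
      simp [twoValued, Finset.mem_compl.mp hv]]
  simp

theorem prod_twoValued (S : Finset V) (a b : ℂ) :
    ∏ v, S.twoValued a b v = a ^ S.card * b ^ Sᶜ.card := by
  rw [← Finset.prod_mul_prod_compl S,
    Finset.prod_congr rfl (g := fun _ => a) fun v hv => by simp [twoValued, hv],
    Finset.prod_congr (s₁ := Sᶜ) rfl (g := fun _ => b) fun v hv => by
      simp [twoValued, Finset.mem_compl.mp hv]]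
  simp

theorem card_add_card_compl' (S : Finset V) : (S.card : ℂ) + Sᶜ.card = Fintype.card V := by
  exact_mod_cast Finset.card_add_card_compl S

end Finset

/-! ### Linear algebra of semi-regular bipartite matrices -/

namespace Matrix

variable {V W : Type*} [Fintype V] [DecidableEq V] [Fintype W] [DecidableEq W]

/-- `M` is the adjacency matrix of a multigraph which is semi-regular bipartite with parts `S`
and `Sᶜ` and degrees `p` and `q`. -/
structure IsSemiregular (M : Matrix V V ℂ) (S : Finset V) (p q : ℕ) : Prop where
  nat_apply : ∀ v w, ∃ k : ℕ, M v w = k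
  eq_zero : ∀ v w, (v ∈ S ↔ w ∈ S) → M v w = 0
  row_sum : ∀ v, ∑ w, M v w = S.twoValued (p : ℂ) q v
  card_mul : S.card * p = Sᶜ.card * q
  nonempty : S.Nonempty
  nonempty_compl : Sᶜ.Nonempty

namespace IsSemiregular

variable {M : Matrix V V ℂ} {S : Finset V} {p q : ℕ}

theorem sum_norm (hM : M.IsSemiregular S p q) (v : V) :
    ∑ w, ‖M v w‖ = S.twoValued (p : ℝ) q v := by
  have h : ∀ w, M v w = (‖M v w‖ : ℂ) := by
    intro w
    obtain ⟨k, hk⟩ := hM.nat_apply v w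
    rw [hk]
    simp
  have h1 := hM.row_sum v
  rw [Finset.sum_congr rfl fun w _ => h w] at h1
  simp only [Finset.twoValued] at h1 ⊢
  split_ifs at h1 ⊢ <;> exact_mod_cast h1

theorem mul_twoValued (hM : M.IsSemiregular S p q) (α β : ℂ) (v : V) :
    ∑ w, M v w * S.twoValued α β w = S.twoValued (p * β) (q * α) v := by
  have hrow := hM.row_sum v
  by_cases hv : v ∈ S
  · simp only [Finset.twoValued, hv, if_true] at hrow ⊢
    rw [← hrow, Finset.sum_mul]
    refine Finset.sum_congr rfl fun w _ => ?_
    by_cases hw : w ∈ S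
    · simp [hM.eq_zero v w (by simp [hv, hw])]
    · simp [hw]
  · simp only [Finset.twoValued, hv, if_false] at hrow ⊢
    rw [← hrow, Finset.sum_mul]
    refine Finset.sum_congr rfl fun w _ => ?_
    by_cases hw : w ∈ S
    · simp [hw]
    · simp [hM.eq_zero v w (by simp [hv, hw])]

/-- Conjugation by the signs of the bipartition negates `M` and fixes diagonal matrices. -/
theorem det_diagonal_add (hM : M.IsSemiregular S p q) (d : V → ℂ) (u : ℂ) :
    (diagonal d + u • M).det = (diagonal d - u • M).det := by
  set ε : V → ℂ := S.twoValued 1 (-1) with hε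
  have hsq : ∀ v, ε v * ε v = 1 := fun v => by
    simp only [hε, Finset.twoValued]; split_ifs <;> norm_num
  have hconj : diagonal ε * (diagonal d + u • M) * diagonal ε = diagonal d - u • M := by
    ext v w
    rw [mul_diagonal, diagonal_mul]
    simp only [add_apply, sub_apply, smul_apply, diagonal_apply, smul_eq_mul]
    by_cases hvw : v = w
    · subst hvw
      rw [hM.eq_zero v v Iff.rfl, if_pos rfl]
      linear_combination d v * hsq v
    · rw [if_neg hvw]
      by_cases h : v ∈ S ↔ w ∈ S
      · simp [hM.eq_zero v w h]
      · have : ε v * ε w = -1 := by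
          simp only [hε, Finset.twoValued]
          by_cases hv : v ∈ S <;> by_cases hw : w ∈ S <;> simp_all
        linear_combination (u * M v w) * this
  have hdet : (diagonal ε).det * (diagonal ε).det = 1 := by
    rw [← det_mul, diagonal_mul_diagonal]
    simp [hsq]
  rw [← hconj, det_mul, det_mul]
  linear_combination (-(diagonal d + u • M).det) * hdet

/-- Since `M` only links the two parts, row and column scalings constant on the parts turn the
diagonal values `a`, `b` into one common value, the geometric mean `y`. -/
theorem det_eq_charpoly (hM : M.IsSemiregular S p q) {a b u y : ℂ} (hy : y ^ 2 = a * b)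
    (hy0 : y ≠ 0) (hu : u ≠ 0) :
    (diagonal (S.twoValued a b) - u • M).det
      = a ^ S.card * b ^ Sᶜ.card * (u / y) ^ Fintype.card V * M.charpoly.eval (y / u) := by
  have ha : a ≠ 0 := by
    rintro rfl
    simp at hy
    exact hy0 hy
  have hconj : diagonal (S.twoValued a b) - u • M
      = diagonal (S.twoValued a y) * (scalar V (y / u) - M)
        * diagonal (S.twoValued (u / y) (u / a)) := by
    ext v w
    rw [mul_diagonal, diagonal_mul]
    simp only [sub_apply, smul_apply, diagonal_apply, smul_eq_mul, scalar_apply]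
    by_cases hvw : v = w
    · subst hvw
      rw [hM.eq_zero v v Iff.rfl, if_pos rfl, if_pos rfl]
      simp only [Finset.twoValued]
      split_ifs
      · field_simp
        ring
      · field_simp
        linear_combination -hy
    · rw [if_neg hvw, if_neg hvw]
      by_cases h : v ∈ S ↔ w ∈ S
      · simp [hM.eq_zero v w h]
      · simp only [Finset.twoValued]
        by_cases hv : v ∈ S <;> by_cases hw : w ∈ S <;> simp_all <;> field_simp
  rw [hconj, det_mul, det_mul, det_diagonal, det_diagonal, Finset.prod_twoValued,
    Finset.prod_twoValued, eval_charpoly, ← Finset.card_add_card_compl S]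
  have hy2 : b = y ^ 2 / a := by rw [hy]; field_simp
  rw [hy2]
  simp only [div_pow, pow_add]
  field_simp
  ring

theorem det_ne_zero (hM : M.IsSemiregular S p q) {a b u : ℝ} (ha : |u| * p < a)
    (hb : |u| * q < b) :
    (diagonal (S.twoValued (a : ℂ) b) - (u : ℂ) • M).det ≠ 0 := by
  apply det_ne_zero_of_sum_row_lt_diag
  intro v
  have h1 : ∑ w ∈ Finset.univ.erase v, ‖(diagonal (S.twoValued (a : ℂ) b) - (u : ℂ) • M) v w‖
      ≤ |u| * S.twoValued (p : ℝ) q v := by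
    rw [← hM.sum_norm, Finset.mul_sum]
    refine (Finset.sum_le_sum (g := fun w => |u| * ‖M v w‖) fun w hw => ?_).trans
      (Finset.sum_le_sum_of_subset_of_nonneg (Finset.erase_subset _ _) fun _ _ _ => by positivity)
    have : v ≠ w := (Finset.ne_of_mem_erase hw).symm
    simp [this]
  refine h1.trans_lt ?_
  simp only [sub_apply, smul_apply, diagonal_apply, hM.eq_zero v v Iff.rfl, if_true, smul_zero,
    sub_zero]
  simp only [Finset.twoValued]
  have hp : 0 ≤ |u| * p := by positivity
  have hq : 0 ≤ |u| * q := by positivity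
  split_ifs
  · rwa [Complex.norm_real, Real.norm_of_nonneg (hp.trans ha.le)]
  · rwa [Complex.norm_real, Real.norm_of_nonneg (hq.trans hb.le)]

/-- The bipartition is equitable, so the solution may be taken constant on each part; a 2-by-2
system with determinant $ab-u^2pq$ remains. -/
theorem exists_mulVec_eq_one (hM : M.IsSemiregular S p q) {a b u : ℂ}
    (hΔ : a * b - u ^ 2 * (p * q) ≠ 0) :
    ∃ x : V → ℂ, (diagonal (S.twoValued a b) - u • M) *ᵥ x = 1 ∧
      ∑ v, x v = (S.card * b + Sᶜ.card * a + 2 * u * (S.card * p)) / (a * b - u ^ 2 * (p * q)) := by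
  set Δ := a * b - u ^ 2 * (p * q) with hΔdef
  refine ⟨S.twoValued ((b + u * p) / Δ) ((a + u * q) / Δ), ?_, ?_⟩
  · ext v
    rw [sub_mulVec, smul_mulVec, Pi.sub_apply, mulVec_diagonal, Pi.smul_apply, Pi.one_apply,
      mulVec, dotProduct, hM.mul_twoValued]
    simp only [Finset.twoValued, smul_eq_mul]
    split_ifs
    · field_simp
      rw [hΔdef]
      ring
    · field_simp
      rw [hΔdef]
      ring
  · have h : (S.card : ℂ) * p = Sᶜ.card * q := by exact_mod_cast hM.card_mul
    rw [Finset.sum_twoValued]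
    field_simp
    linear_combination -u * h

theorem eq_zero_of_mul_eq_zero (hM : M.IsSemiregular S p q) (h : S.card * p = 0) :
    p = 0 ∧ q = 0 ∧ M = 0 := by
  have hp : p = 0 := (Nat.mul_eq_zero.mp h).resolve_left hM.nonempty.card_pos.ne'
  have hq : q = 0 :=
    (Nat.mul_eq_zero.mp (hM.card_mul.symm.trans h)).resolve_left hM.nonempty_compl.card_pos.ne'
  refine ⟨hp, hq, ?_⟩
  ext v w
  have h1 := hM.sum_norm v
  have h2 : S.twoValued (p : ℝ) q v = 0 := by simp [Finset.twoValued, hp, hq]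
  rw [h2, Finset.sum_eq_zero_iff_of_nonneg fun _ _ => norm_nonneg _] at h1
  simpa using h1 w (Finset.mem_univ w)

theorem charpoly_comp_neg (hM : M.IsSemiregular S p q) :
    M.charpoly.comp (-Polynomial.X) = (-1) ^ Fintype.card V * M.charpoly := by
  refine Polynomial.funext fun x => ?_
  have h := hM.det_diagonal_add (fun _ => x) 1
  rw [one_smul] at h
  simp only [Polynomial.eval_comp, Polynomial.eval_neg, Polynomial.eval_X, Polynomial.eval_mul,
    Polynomial.eval_pow, Polynomial.eval_one, eval_charpoly, scalar_apply]
  rw [← h, ← det_neg]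
  congr 1
  ext v w
  simp only [sub_apply, neg_apply, add_apply, diagonal_apply]
  split_ifs <;> ring

end IsSemiregular

/-- The solutions `x`, `y` let the diagonal blocks be factored out without inverting them; the Schur
complement left over is the identity minus a rank-one matrix. -/
theorem det_fromBlocks_of_mulVec_eq_one (M : Matrix V V ℂ) (N : Matrix W W ℂ) (u : ℂ)
    {x : V → ℂ} {y : W → ℂ} (hx : M *ᵥ x = 1) (hy : N *ᵥ y = 1) :
    (fromBlocks M (of fun _ _ => -u) (of fun _ _ => -u) N).det
      = M.det * N.det * (1 - u ^ 2 * (∑ v, x v) * ∑ w, y w) := by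
  have hfac : fromBlocks M (of fun _ _ => -u) (of fun _ _ => -u) N
      = fromBlocks M 0 0 N * fromBlocks 1 (of fun v _ => -u * x v) (of fun w _ => -u * y w) 1 := by
    rw [fromBlocks_multiply]
    congr 1
    · simp
    · ext v w
      have := congrFun hx v
      simp only [mulVec, dotProduct, Pi.one_apply] at this
      simp only [of_apply, Matrix.zero_mul, Matrix.add_apply, mul_apply, zero_apply, add_zero]
      simp only [mul_left_comm _ (-u), ← Finset.mul_sum, this, mul_one]
    · ext v w
      have := congrFun hy v
      simp only [mulVec, dotProduct, Pi.one_apply] at this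
      simp only [of_apply, Matrix.zero_mul, Matrix.add_apply, mul_apply, zero_apply, zero_add]
      simp only [mul_left_comm _ (-u), ← Finset.mul_sum, this, mul_one]
    · simp
  have hprod : (of fun w (_ : V) => -u * y w) * (of fun v (_ : W) => -u * x v)
      = replicateCol Unit (fun w => u ^ 2 * (∑ v, x v) * y w) * replicateRow Unit (1 : W → ℂ) := by
    ext w w'
    simp only [mul_apply, of_apply, replicateCol_apply, replicateRow_apply, Pi.one_apply]
    rw [← Finset.mul_sum, ← Finset.mul_sum]
    simp
    ring
  rw [hfac, det_mul, det_fromBlocks_zero₂₁, det_fromBlocks_one₁₁, hprod, det_one_sub_mul_comm,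
    det_unique (n := Unit)]
  simp [mul_apply, Finset.mul_sum]

end Matrix

theorem Nat.card_subtype_eq_sum {α : Type*} [Fintype α] (P : α → Prop) [DecidablePred P] :
    Nat.card {a // P a} = ∑ a, if P a then 1 else 0 := by
  rw [Nat.card_eq_fintype_card, Fintype.card_subtype, Finset.card_filter]

/-! ### Adjacency matrices and degrees of bipartite graphs and joins -/

namespace OrientedEdgeGraph

variable {V W D D' : Type*}

section Degree

variable [DecidableEq V] [Fintype D]

theorem sum_degree (G : OrientedEdgeGraph V D) (S : Finset V) :
    ∑ v ∈ S, G.degree v = Fintype.card {d : D // G.src d ∈ S} := by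
  simp only [degree, Nat.card_eq_fintype_card, Fintype.card_subtype]
  rw [Finset.card_eq_sum_card_fiberwise (f := G.src) (t := S) (by intro d; simp)]
  refine Finset.sum_congr rfl fun v hv => ?_
  rw [Finset.filter_filter]
  congr 1
  ext d
  simp only [Finset.mem_filter, Finset.mem_univ, true_and]
  exact ⟨fun h => ⟨h ▸ hv, h⟩, fun h => h.2⟩

variable [Fintype V]

theorem sum_adjMatrix (G : OrientedEdgeGraph V D) (v : V) :
    ∑ w, G.adjMatrix v w = G.degree v := by
  simp only [adjMatrix, Matrix.of_apply, degree, Nat.card_eq_fintype_card, Fintype.card_subtype]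
  rw [← Nat.cast_sum, Finset.card_eq_sum_card_fiberwise (f := G.tgt) (t := Finset.univ) (by simp)]
  simp only [Finset.filter_filter]

theorem IsSemiregularBipartite.exists_isSemiregular {G : OrientedEdgeGraph V D} {p q : ℕ}
    (h : G.IsSemiregularBipartite p q) :
    ∃ S : Finset V, G.adjMatrix.IsSemiregular S p q ∧ Fintype.card D = 2 * (S.card * p) ∧
      ∀ v, (G.degree v : ℂ) = S.twoValued (p : ℂ) q v := by
  classical
  obtain ⟨A, B, hA, hB, hdisj, hunion, hedge, hdA, hdB⟩ := h
  have hmemB : ∀ v, v ∈ B ↔ v ∉ A := fun v =>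
    ⟨fun h1 h2 => Set.disjoint_left.mp hdisj h2 h1, fun h1 =>
      ((hunion ▸ Set.mem_univ v : v ∈ A ∪ B)).resolve_left h1⟩
  simp only [hmemB] at hedge hdB
  obtain ⟨S, rfl⟩ : ∃ S : Finset V, A = S := ⟨A.toFinset, by simp⟩
  simp only [Finset.mem_coe] at *
  have hdeg : ∀ v, (G.degree v : ℂ) = S.twoValued (p : ℂ) q v := by
    intro v
    simp only [Finset.twoValued]
    split_ifs with hv
    · rw [hdA v hv]
    · rw [hdB v hv]
  have h1 : S.card * p = Fintype.card {d : D // G.src d ∈ S} := by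
    rw [← sum_degree, Finset.sum_congr rfl hdA, Finset.sum_const, smul_eq_mul]
  have h2 : Sᶜ.card * q = Fintype.card {d : D // G.src d ∉ S} := by
    have := G.sum_degree Sᶜ
    simp only [Finset.mem_compl] at this
    rw [← this, Finset.sum_congr rfl fun v hv => hdB v (Finset.mem_compl.mp hv), Finset.sum_const,
      smul_eq_mul]
  -- Reversal exchanges the oriented edges leaving the two parts.
  have h3 : Fintype.card {d : D // G.src d ∈ S} = Fintype.card {d : D // G.src d ∉ S} := by
    refine Fintype.card_congr ⟨fun d => ⟨G.inv d.1, ?_⟩, fun d => ⟨G.inv d.1, ?_⟩,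
      fun d => Subtype.ext (G.inv_inv _), fun d => Subtype.ext (G.inv_inv _)⟩
    · have := hedge d.1
      have := d.2
      simp only [tgt] at *
      tauto
    · have := hedge d.1
      have := d.2
      simp only [tgt] at *
      tauto
  refine ⟨S, ⟨fun v w => ⟨_, rfl⟩, ?_, fun v => by rw [sum_adjMatrix, hdeg], ?_, by simpa using hA,
    ?_⟩, ?_, hdeg⟩
  · intro v w hvw
    simp only [adjMatrix, Matrix.of_apply, Nat.cast_eq_zero]
    have : IsEmpty {d : D // G.src d = v ∧ G.tgt d = w} := by
      refine ⟨?_⟩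
      rintro ⟨d, rfl, rfl⟩
      have := hedge d
      tauto
    exact Nat.card_of_isEmpty
  · rw [h1, h2, h3]
  · obtain ⟨v, hv⟩ := hB
    exact ⟨v, Finset.mem_compl.mpr ((hmemB v).mp hv)⟩
  · have h4 := Fintype.card_subtype_compl fun d : D => G.src d ∈ S
    have h5 := Fintype.card_subtype_le fun d : D => G.src d ∈ S
    omega

end Degree

section Join

variable [Fintype V] [DecidableEq V] [Fintype W] [DecidableEq W] [Fintype D] [Fintype D']
  (G : OrientedEdgeGraph V D) (H : OrientedEdgeGraph W D')

theorem adjMatrix_join : (G.join H).adjMatrix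
    = Matrix.fromBlocks G.adjMatrix (Matrix.of fun _ _ => 1) (Matrix.of fun _ _ => 1)
      H.adjMatrix := by
  classical
  ext (v | w) (v' | w') <;>
  simp only [adjMatrix, Matrix.of_apply, Nat.card_subtype_eq_sum, Fintype.sum_sum_type,
    Matrix.fromBlocks_apply₁₁, Matrix.fromBlocks_apply₁₂, Matrix.fromBlocks_apply₂₁,
    Matrix.fromBlocks_apply₂₂] <;>
  simp [join, tgt, ite_and, Fintype.sum_prod_type, -Finset.sum_boole] <;>
  exact Finset.sum_congr rfl fun d _ => by split_ifs <;> simp_all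

theorem degree_join_inl (v : V) :
    (G.join H).degree (.inl v) = G.degree v + Fintype.card W := by
  classical
  simp only [degree, Nat.card_subtype_eq_sum, Fintype.sum_sum_type]
  simp [join, Fintype.sum_prod_type, -Finset.sum_boole]
  rw [Finset.sum_comm]
  simp

theorem degree_join_inr (w : W) :
    (G.join H).degree (.inr w) = H.degree w + Fintype.card V := by
  classical
  simp only [degree, Nat.card_subtype_eq_sum, Fintype.sum_sum_type]
  simp [join, Fintype.sum_prod_type, -Finset.sum_boole]
  rw [Finset.sum_comm]
  simp

end Join

end OrientedEdgeGraph

/-- The sizes `n₁`, `n₂` of the two parts and the degrees `d₁`, `d₂` of their vertices, for a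
semi-regular bipartite multigraph. -/
structure SemiregularType where
  n₁ : ℕ
  n₂ : ℕ
  d₁ : ℕ
  d₂ : ℕ

/-! ### Quotient data and positivity for $|u|\ge 1$ -/

namespace SemiregularType

/-- The number of vertices. -/
def order (P : SemiregularType) : ℕ := P.n₁ + P.n₂

/-- The number of edges. -/
def size (P : SemiregularType) : ℕ := P.n₁ * P.d₁

/-- Edges can be counted from either side, and both sides are non-empty. -/
structure Valid (P : SemiregularType) : Prop where
  pos₁ : 0 < P.n₁
  pos₂ : 0 < P.n₂
  count : P.n₁ * P.d₁ = P.n₂ * P.d₂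

/-- The entry of `1 + t (D - 1)` at the first part after joining with `k` vertices. -/
def diag₁ (P : SemiregularType) (k : ℕ) (t : ℝ) : ℝ := 1 + t * (P.d₁ + k - 1)

/-- The entry of `1 + t (D - 1)` at the second part after joining with `k` vertices. -/
def diag₂ (P : SemiregularType) (k : ℕ) (t : ℝ) : ℝ := 1 + t * (P.d₂ + k - 1)

/-- The determinant of the quotient matrix. -/
def disc (P : SemiregularType) (k : ℕ) (t : ℝ) : ℝ :=
  P.diag₁ k t * P.diag₂ k t - t * (P.d₁ * P.d₂)

/-- The even part of the numerator of the main function of the quotient. -/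
def mass (P : SemiregularType) (k : ℕ) (t : ℝ) : ℝ :=
  P.n₁ * P.diag₂ k t + P.n₂ * P.diag₁ k t

variable {P : SemiregularType}

theorem diag₁_pos {k : ℕ} (hk : 1 ≤ k) {t : ℝ} (ht : 0 ≤ t) : 0 < P.diag₁ k t := by
  have : (1 : ℝ) ≤ k := by exact_mod_cast hk
  have : (0 : ℝ) ≤ P.d₁ + k - 1 := by linarith [(Nat.cast_nonneg P.d₁ : (0 : ℝ) ≤ P.d₁)]
  unfold diag₁
  positivity

theorem diag₂_pos {k : ℕ} (hk : 1 ≤ k) {t : ℝ} (ht : 0 ≤ t) : 0 < P.diag₂ k t :=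
  diag₁_pos (P := ⟨P.n₂, P.n₁, P.d₂, P.d₁⟩) hk ht

/-- This is strict diagonal dominance: $|u|\le u^2$ bounds the row by $u^2d_1$, and $1+u^2(k-1)>0$
remains. The case $|u|=1$ is needed for the order of vanishing at $u=1$. -/
theorem abs_mul_lt_diag₁ {k : ℕ} (hk : 1 ≤ k) {u : ℝ} (hu : 1 ≤ |u|) :
    |u| * P.d₁ < P.diag₁ k (u ^ 2) := by
  have h1 : (1 : ℝ) ≤ k := by exact_mod_cast hk
  have h2 : (0 : ℝ) ≤ P.d₁ := Nat.cast_nonneg _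
  unfold diag₁
  rw [← sq_abs]
  have h3 : |u| * P.d₁ ≤ |u| ^ 2 * P.d₁ := by
    apply mul_le_mul_of_nonneg_right _ h2
    nlinarith
  nlinarith [mul_nonneg (sq_nonneg |u|) (sub_nonneg.mpr h1)]

theorem abs_mul_lt_diag₂ {k : ℕ} (hk : 1 ≤ k) {u : ℝ} (hu : 1 ≤ |u|) :
    |u| * P.d₂ < P.diag₂ k (u ^ 2) :=
  abs_mul_lt_diag₁ (P := ⟨P.n₂, P.n₁, P.d₂, P.d₁⟩) hk hu

theorem disc_pos {k : ℕ} (hk : 1 ≤ k) {u : ℝ} (hu : 1 ≤ |u|) : 0 < P.disc k (u ^ 2) := by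
  have h := mul_lt_mul'' (P.abs_mul_lt_diag₁ hk hu) (P.abs_mul_lt_diag₂ hk hu) (by positivity)
    (by positivity)
  unfold disc
  rw [← sq_abs] at h ⊢
  linarith [h, show |u| * (P.d₁ : ℝ) * (|u| * P.d₂) = |u| ^ 2 * (P.d₁ * P.d₂) by ring]

theorem mass_pos (hP : P.Valid) {k : ℕ} (hk : 1 ≤ k) {t : ℝ} (ht : 0 ≤ t) : 0 < P.mass k t := by
  have h1 := P.diag₁_pos hk ht
  have h2 := P.diag₂_pos hk ht
  have h3 := hP.pos₁
  have h4 := hP.pos₂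
  unfold mass
  positivity

end SemiregularType

namespace Matrix

variable {V W : Type*} [Fintype V] [DecidableEq V] [Fintype W] [DecidableEq W]

theorem diagonal_twoValued_self_sub (S : Finset V) (x : ℂ) (A : Matrix V V ℂ) :
    diagonal (S.twoValued x x) - (1 : ℂ) • A = scalar V x - A := by
  rw [one_smul, scalar_apply]
  congr 2
  ext
  simp [Finset.twoValued]

/-- The type of a semi-regular bipartite multigraph with parts `S`, `Sᶜ`. -/
def semiregularType (S : Finset V) (p q : ℕ) : SemiregularType := ⟨S.card, Sᶜ.card, p, q⟩

/-- The determinant of the block of `1 - u A + u² (D - 1)` belonging to `M`, after joining with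
`k` vertices. -/
noncomputable def iharaBlock (M : Matrix V V ℂ) (S : Finset V) (p q k : ℕ) (u : ℝ) : ℂ :=
  (diagonal (S.twoValued ((semiregularType S p q).diag₁ k (u ^ 2) : ℂ)
    ((semiregularType S p q).diag₂ k (u ^ 2))) - (u : ℂ) • M).det

namespace IsSemiregular

variable {M : Matrix V V ℂ} {S : Finset V} {p q k : ℕ}

theorem valid (hM : M.IsSemiregular S p q) : (semiregularType S p q).Valid :=
  ⟨hM.nonempty.card_pos, hM.nonempty_compl.card_pos, hM.card_mul⟩

theorem order_semiregularType : (semiregularType S p q).order = Fintype.card V :=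
  Finset.card_add_card_compl S

theorem iharaBlock_neg (hM : M.IsSemiregular S p q) (u : ℝ) :
    iharaBlock M S p q k (-u) = iharaBlock M S p q k u := by
  unfold iharaBlock
  rw [neg_sq, Complex.ofReal_neg, neg_smul, sub_neg_eq_add, hM.det_diagonal_add]

theorem iharaBlock_ne_zero (hM : M.IsSemiregular S p q) (hk : 1 ≤ k) {u : ℝ} (hu : 1 ≤ |u|) :
    iharaBlock M S p q k u ≠ 0 :=
  hM.det_ne_zero ((semiregularType S p q).abs_mul_lt_diag₁ hk hu)
    ((semiregularType S p q).abs_mul_lt_diag₂ hk hu)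

theorem continuous_iharaBlock : Continuous (iharaBlock M S p q k) := by
  unfold iharaBlock SemiregularType.diag₁ SemiregularType.diag₂
  refine Continuous.matrix_det (Continuous.sub (Continuous.matrix_diagonal ?_) (by fun_prop))
  refine continuous_pi fun v => ?_
  unfold Finset.twoValued
  split_ifs <;> fun_prop

theorem iharaBlock_eq (hM : M.IsSemiregular S p q) (hk : 1 ≤ k) {u : ℝ} (hu : u ≠ 0) :
    iharaBlock M S p q k u
      = ((semiregularType S p q).diag₁ k (u ^ 2) ^ (semiregularType S p q).n₁
          * (semiregularType S p q).diag₂ k (u ^ 2) ^ (semiregularType S p q).n₂ : ℝ)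
        * ((u / √((semiregularType S p q).diag₁ k (u ^ 2)
          * (semiregularType S p q).diag₂ k (u ^ 2)) : ℝ) : ℂ) ^ Fintype.card V
        * M.charpoly.eval ((√((semiregularType S p q).diag₁ k (u ^ 2)
          * (semiregularType S p q).diag₂ k (u ^ 2)) / u : ℝ) : ℂ) := by
  have h1 := (semiregularType S p q).diag₁_pos hk (sq_nonneg u)
  have h2 := (semiregularType S p q).diag₂_pos hk (sq_nonneg u)
  have hpos := mul_pos h1 h2
  unfold iharaBlock
  rw [hM.det_eq_charpoly (y := (√((semiregularType S p q).diag₁ k (u ^ 2)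
          * (semiregularType S p q).diag₂ k (u ^ 2)) : ℝ))]
  · push_cast
    rfl
  · rw [← Complex.ofReal_pow, Real.sq_sqrt hpos.le]
    push_cast
    rfl
  · exact_mod_cast (Real.sqrt_pos.mpr hpos).ne'
  · exact_mod_cast hu

end IsSemiregular

end Matrix

/-! ### Determinant formulas for joins -/

namespace OrientedEdgeGraph

open Matrix

variable {V W D D' : Type*} [Fintype V] [DecidableEq V] [Fintype W] [DecidableEq W]
  [Fintype D] [Fintype D']

/-- Bass's formula combined with the rank-one block determinant, with denominators cleared. The only
terms not visibly even in $u$ are the block determinants, which are even by bipartiteness, and the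
two summands $2u\cdot$`size`. -/
theorem ihara_join [DecidableEq D] [DecidableEq D']
    (G : OrientedEdgeGraph V D) (H : OrientedEdgeGraph W D')
    {S : Finset V} {T : Finset W} {p q p' q' : ℕ}
    (hG : G.adjMatrix.IsSemiregular S p q) (hH : H.adjMatrix.IsSemiregular T p' q')
    (hGd : ∀ v, (G.degree v : ℂ) = S.twoValued (p : ℂ) q v)
    (hHd : ∀ v, (H.degree v : ℂ) = T.twoValued (p' : ℂ) q' v)
    {m : ℕ} (hm : Fintype.card ((D ⊕ D') ⊕ (V × W ⊕ W × V)) = 2 * m) {u : ℝ} (hu : 1 < |u|) :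
    ((1 - u ^ 2 : ℝ) : ℂ) ^ (Fintype.card V + Fintype.card W)
        * (ofRel (G.join H).Follows).charpolyRev.eval (u : ℂ)
        * (((semiregularType S p q).disc (Fintype.card W) (u ^ 2)
          * (semiregularType T p' q').disc (Fintype.card V) (u ^ 2) : ℝ) : ℂ)
      = ((1 - u ^ 2 : ℝ) : ℂ) ^ m
        * (iharaBlock G.adjMatrix S p q (Fintype.card W) u
          * iharaBlock H.adjMatrix T p' q' (Fintype.card V) u)
        * (((semiregularType S p q).disc (Fintype.card W) (u ^ 2)
          * (semiregularType T p' q').disc (Fintype.card V) (u ^ 2)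
          - u ^ 2 * ((semiregularType S p q).mass (Fintype.card W) (u ^ 2)
              + 2 * u * (semiregularType S p q).size)
            * ((semiregularType T p' q').mass (Fintype.card V) (u ^ 2)
              + 2 * u * (semiregularType T p' q').size) : ℝ) : ℂ) := by
  have hV : 1 ≤ Fintype.card V := hG.nonempty.card_pos.trans_le S.card_le_univ
  have hW : 1 ≤ Fintype.card W := hH.nonempty.card_pos.trans_le T.card_le_univ
  have hc : (1 - (u : ℂ) ^ 2) ≠ 0 := by
    have : (1 - u ^ 2 : ℝ) ≠ 0 := by
      have := (one_lt_sq_iff_one_lt_abs u).mpr hu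
      linarith
    exact_mod_cast this
  have hd1 := ((semiregularType S p q).disc_pos hW hu.le).ne'
  have hd2 := ((semiregularType T p' q').disc_pos hV hu.le).ne'
  have hc1 : (((semiregularType S p q).disc (Fintype.card W) (u ^ 2) : ℝ) : ℂ) ≠ 0 := by
    exact_mod_cast hd1
  have hc2 : (((semiregularType T p' q').disc (Fintype.card V) (u ^ 2) : ℝ) : ℂ) ≠ 0 := by
    exact_mod_cast hd2
  have he1 : (((semiregularType S p q).disc (Fintype.card W) (u ^ 2) : ℝ) : ℂ)
      = (semiregularType S p q).diag₁ (Fintype.card W) (u ^ 2)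
        * (semiregularType S p q).diag₂ (Fintype.card W) (u ^ 2) - (u : ℂ) ^ 2 * (p * q) := by
    simp [SemiregularType.disc, semiregularType]
  have he2 : (((semiregularType T p' q').disc (Fintype.card V) (u ^ 2) : ℝ) : ℂ)
      = (semiregularType T p' q').diag₁ (Fintype.card V) (u ^ 2)
        * (semiregularType T p' q').diag₂ (Fintype.card V) (u ^ 2) - (u : ℂ) ^ 2 * (p' * q') := by
    simp [SemiregularType.disc, semiregularType]
  obtain ⟨x, hx, hxs⟩ := hG.exists_mulVec_eq_one
    (a := (semiregularType S p q).diag₁ (Fintype.card W) (u ^ 2))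
    (b := (semiregularType S p q).diag₂ (Fintype.card W) (u ^ 2)) (u := u)
    (by rw [← he1]; exact hc1)
  obtain ⟨y, hy, hys⟩ := hH.exists_mulVec_eq_one
    (a := (semiregularType T p' q').diag₁ (Fintype.card V) (u ^ 2))
    (b := (semiregularType T p' q').diag₂ (Fintype.card V) (u ^ 2)) (u := u)
    (by rw [← he2]; exact hc2)
  have hdet := det_fromBlocks_of_mulVec_eq_one _ _ (u : ℂ) hx hy
  have hbass := (G.join H).bass hm hc
  have hmat : (diagonal fun v => 1 + (u : ℂ) ^ 2 * (((G.join H).degree v : ℂ) - 1))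
      - (u : ℂ) • (G.join H).adjMatrix
      = fromBlocks (diagonal (S.twoValued
          ((semiregularType S p q).diag₁ (Fintype.card W) (u ^ 2) : ℂ)
          ((semiregularType S p q).diag₂ (Fintype.card W) (u ^ 2))) - (u : ℂ) • G.adjMatrix)
        (of fun _ _ => -(u : ℂ)) (of fun _ _ => -(u : ℂ))
        (diagonal (T.twoValued
          ((semiregularType T p' q').diag₁ (Fintype.card V) (u ^ 2) : ℂ)
          ((semiregularType T p' q').diag₂ (Fintype.card V) (u ^ 2))) - (u : ℂ) • H.adjMatrix) := by
    rw [adjMatrix_join]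
    ext (v | w) (v' | w')
    · simp only [Matrix.sub_apply, Matrix.smul_apply, fromBlocks_apply₁₁, diagonal_apply, Sum.inl.injEq,
        degree_join_inl, Nat.cast_add, hGd]
      congr 1
      refine if_congr Iff.rfl ?_ rfl
      simp only [Finset.twoValued, SemiregularType.diag₁, SemiregularType.diag₂, semiregularType]
      split_ifs <;> push_cast <;> ring
    · simp
    · simp
    · simp only [Matrix.sub_apply, Matrix.smul_apply, fromBlocks_apply₂₂, diagonal_apply, Sum.inr.injEq,
        degree_join_inr, Nat.cast_add, hHd]
      congr 1
      refine if_congr Iff.rfl ?_ rfl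
      simp only [Finset.twoValued, SemiregularType.diag₁, SemiregularType.diag₂, semiregularType]
      split_ifs <;> push_cast <;> ring
  rw [hmat, hdet, hxs, hys, Fintype.card_sum, ← eval_charpolyRev_eq] at hbass
  rw [← he1, ← he2] at hbass
  push_cast
  rw [hbass]
  simp only [SemiregularType.mass, SemiregularType.size, iharaBlock, semiregularType]
  simp only [semiregularType] at hc1 hc2
  push_cast
  field_simp

/-- The same block computation with `u = 1` and constant diagonal `x`, valid away from the finitely
many zeros of the cleared denominators. -/
theorem charpoly_join (G : OrientedEdgeGraph V D) (H : OrientedEdgeGraph W D')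
    {S : Finset V} {T : Finset W} {p q p' q' : ℕ}
    (hG : G.adjMatrix.IsSemiregular S p q) (hH : H.adjMatrix.IsSemiregular T p' q') :
    (G.join H).adjMatrix.charpoly
        * ((Polynomial.X ^ 2 - Polynomial.C ((p * q : ℕ) : ℂ))
          * (Polynomial.X ^ 2 - Polynomial.C ((p' * q' : ℕ) : ℂ)))
      = G.adjMatrix.charpoly * H.adjMatrix.charpoly
        * ((Polynomial.X ^ 2 - Polynomial.C ((p * q : ℕ) : ℂ))
          * (Polynomial.X ^ 2 - Polynomial.C ((p' * q' : ℕ) : ℂ))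
          - (Polynomial.C (Fintype.card V : ℂ) * Polynomial.X
              + Polynomial.C (2 * (semiregularType S p q).size : ℂ))
            * (Polynomial.C (Fintype.card W : ℂ) * Polynomial.X
              + Polynomial.C (2 * (semiregularType T p' q').size : ℂ))) := by
  have hmonic : ∀ k : ℂ, (Polynomial.X ^ 2 - Polynomial.C k : Polynomial ℂ) ≠ 0 := fun k =>
    Polynomial.X_pow_sub_C_ne_zero two_pos k
  refine Polynomial.eq_of_infinite_eval_eq _ _ (Set.Infinite.mono ?_
    (((Polynomial.X ^ 2 - Polynomial.C ((p * q : ℕ) : ℂ))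
      * (Polynomial.X ^ 2 - Polynomial.C ((p' * q' : ℕ) : ℂ))).roots.toFinset.finite_toSet
      |>.infinite_compl))
  intro x hx
  simp only [Set.mem_compl_iff, Finset.mem_coe, Multiset.mem_toFinset,
    Polynomial.mem_roots (mul_ne_zero (hmonic _) (hmonic _)), Polynomial.IsRoot,
    Polynomial.eval_mul, Polynomial.eval_sub, Polynomial.eval_pow, Polynomial.eval_X,
    Polynomial.eval_C, mul_eq_zero, not_or] at hx
  obtain ⟨h1, h2⟩ := hx
  push_cast at h1 h2
  obtain ⟨y, hy, hys⟩ := hG.exists_mulVec_eq_one (a := x) (b := x) (u := 1)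
    (by simpa [← sq] using h1)
  obtain ⟨z, hz, hzs⟩ := hH.exists_mulVec_eq_one (a := x) (b := x) (u := 1)
    (by simpa [← sq] using h2)
  rw [diagonal_twoValued_self_sub] at hy hz
  have hdet := det_fromBlocks_of_mulVec_eq_one _ _ (1 : ℂ) hy hz
  have hmat : scalar (V ⊕ W) x - (G.join H).adjMatrix
      = fromBlocks (scalar V x - G.adjMatrix) (of fun _ _ => -1) (of fun _ _ => -1)
        (scalar W x - H.adjMatrix) := by
    rw [adjMatrix_join]
    ext (v | w) (v' | w') <;> simp [diagonal_apply]
  rw [← hmat, hys, hzs] at hdet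
  simp only [Set.mem_ofPred_eq, Polynomial.eval_mul, Polynomial.eval_sub, Polynomial.eval_add,
    Polynomial.eval_pow, Polynomial.eval_X, Polynomial.eval_C, eval_charpoly, hdet,
    ← Finset.card_add_card_compl' S, ← Finset.card_add_card_compl' T, SemiregularType.size,
    semiregularType]
  push_cast
  have h1' : x * x - 1 ^ 2 * ((p : ℂ) * q) ≠ 0 := by simpa [← sq] using h1
  have h2' : x * x - 1 ^ 2 * ((p' : ℂ) * q') ≠ 0 := by simpa [← sq] using h2
  field_simp

end OrientedEdgeGraph

/-! ### Recovering the degrees from the even and odd parts -/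

namespace SemiregularType

/-- The odd part, up to a factor, of the main factor of the zeta function of a join. -/
def oddPart (P Q : SemiregularType) (t : ℝ) : ℝ :=
  P.mass Q.order t * Q.size + Q.mass P.order t * P.size

/-- The even part of the main factor of the zeta function of a join. -/
def evenPart (P Q : SemiregularType) (t : ℝ) : ℝ :=
  P.disc Q.order t * Q.disc P.order t - t * (P.mass Q.order t * Q.mass P.order t)
    - 4 * t ^ 2 * (P.size * Q.size)

/-- The leading coefficient of `disc`. -/
def discCoeff (P : SemiregularType) (k : ℕ) : ℝ := (P.d₁ + k - 1) * (P.d₂ + k - 1)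

/-- The leading coefficient of `mass`. -/
def massCoeff (P : SemiregularType) (k : ℕ) : ℝ :=
  P.n₁ * (P.d₂ + k - 1) + P.n₂ * (P.d₁ + k - 1)

variable {P Q Q' : SemiregularType}

theorem disc_eq (P : SemiregularType) (k : ℕ) (t : ℝ) :
    P.disc k t = 1 + (P.d₁ + P.d₂ + 2 * (k - 1) - P.d₁ * P.d₂) * t + P.discCoeff k * t ^ 2 := by
  unfold disc diag₁ diag₂ discCoeff
  ring

theorem mass_eq (P : SemiregularType) (k : ℕ) (t : ℝ) :
    P.mass k t = P.order + P.massCoeff k * t := by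
  unfold mass diag₁ diag₂ massCoeff order
  push_cast
  ring

theorem Valid.two_le_order (hP : P.Valid) : 2 ≤ P.order := by
  have := hP.pos₁
  have := hP.pos₂
  unfold order
  omega

theorem Valid.degree_sum_mul_size (hP : P.Valid) :
    (P.d₁ + P.d₂) * P.size = P.order * (P.d₁ * P.d₂) := by
  unfold size order
  linear_combination P.d₁ * hP.count

theorem Valid.degrees_eq_zero (hP : P.Valid) (h : P.size = 0) : P.d₁ = 0 ∧ P.d₂ = 0 :=
  ⟨(Nat.mul_eq_zero.mp h).resolve_left hP.pos₁.ne',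
    (Nat.mul_eq_zero.mp (hP.count.symm.trans h)).resolve_left hP.pos₂.ne'⟩

/-- Twice the size is $n_1d_1+n_2d_2$. As $n_1d_1=n_2d_2$, the larger part has the smaller degree,
so this is at most $n_1d_2+n_2d_1$ by rearrangement; the terms with $k-1$ make the inequality
strict. -/
theorem Valid.two_mul_size_lt_massCoeff (hP : P.Valid) {k : ℕ} (hk : 2 ≤ k) :
    2 * (P.size : ℝ) < P.massCoeff k := by
  have h1 : (0 : ℝ) < P.n₁ := by exact_mod_cast hP.pos₁
  have h2 : (0 : ℝ) < P.n₂ := by exact_mod_cast hP.pos₂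
  have hc : (P.n₁ : ℝ) * P.d₁ = P.n₂ * P.d₂ := by exact_mod_cast hP.count
  have hk' : (2 : ℝ) ≤ k := by exact_mod_cast hk
  have key : ((P.n₁ : ℝ) - P.n₂) * (P.d₁ - P.d₂) ≤ 0 := by
    rcases le_total P.d₁ P.d₂ with h | h
    · have h' : (P.d₁ : ℝ) ≤ P.d₂ := by exact_mod_cast h
      by_contra! hlt
      have h3 : (P.n₁ : ℝ) < P.n₂ := by nlinarith
      have h4 : (0 : ℝ) ≤ P.d₁ := Nat.cast_nonneg _
      have h5 : (P.d₁ : ℝ) < P.d₂ := by nlinarith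
      nlinarith
    · have h' : (P.d₂ : ℝ) ≤ P.d₁ := by exact_mod_cast h
      by_contra! hlt
      have h3 : (P.n₂ : ℝ) < P.n₁ := by nlinarith
      have h4 : (0 : ℝ) ≤ P.d₂ := Nat.cast_nonneg _
      have h5 : (P.d₂ : ℝ) < P.d₁ := by nlinarith
      nlinarith
  unfold massCoeff size
  push_cast
  have h6 : 0 < (P.n₁ + P.n₂ : ℝ) * (k - 1) := mul_pos (by positivity) (by linarith)
  nlinarith

/-- If there are edges, order, size and degree product determine the degree sum through
`degree_sum_mul_size`, hence the unordered pair of degrees, hence the part sizes. Without edges the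
part sizes stay free, but they then enter only through their sum. -/
theorem eq_or_swap_or_zero (hQ : Q.Valid) (hQ' : Q'.Valid) (ho : Q.order = Q'.order)
    (hs : Q.size = Q'.size) (hd : Q.d₁ * Q.d₂ = Q'.d₁ * Q'.d₂) :
    Q = Q' ∨ Q = ⟨Q'.n₂, Q'.n₁, Q'.d₂, Q'.d₁⟩ ∨
      (Q.d₁ = 0 ∧ Q.d₂ = 0 ∧ Q'.d₁ = 0 ∧ Q'.d₂ = 0) := by
  by_cases h0 : Q.size = 0
  · obtain ⟨h1, h2⟩ := hQ.degrees_eq_zero h0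
    obtain ⟨h3, h4⟩ := hQ'.degrees_eq_zero (hs ▸ h0)
    exact Or.inr (Or.inr ⟨h1, h2, h3, h4⟩)
  have hsum : Q.d₁ + Q.d₂ = Q'.d₁ + Q'.d₂ := by
    refine Nat.eq_of_mul_eq_mul_right (Nat.pos_of_ne_zero h0) ?_
    rw [hQ.degree_sum_mul_size, hs, hQ'.degree_sum_mul_size, ho, hd]
  have hprod : ((Q.d₁ : ℤ) - Q'.d₁) * (Q.d₁ - Q'.d₂) = 0 := by
    zify at hsum hd
    linear_combination (Q.d₁ : ℤ) * hsum - hd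
  have hd₁ : 0 < Q.d₁ := by
    unfold size at h0
    exact Nat.pos_of_ne_zero fun h => h0 (by rw [h, mul_zero])
  have hd₂ : 0 < Q.d₂ := by
    unfold size at h0
    rw [hQ.count] at h0
    exact Nat.pos_of_ne_zero fun h => h0 (by rw [h, mul_zero])
  have hc := hQ.count
  have hc' := hQ'.count
  obtain ⟨n₁, n₂, d₁, d₂⟩ := Q
  obtain ⟨n₁', n₂', d₁', d₂'⟩ := Q'
  simp only [size, order, mk.injEq] at *
  rcases mul_eq_zero.mp hprod with h | h
  · left
    obtain rfl : d₁ = d₁' := by omega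
    obtain rfl : d₂ = d₂' := by omega
    obtain rfl := Nat.eq_of_mul_eq_mul_right hd₁ hs
    exact ⟨rfl, by omega, rfl, rfl⟩
  · right
    left
    obtain rfl : d₁ = d₂' := by omega
    obtain rfl : d₂ = d₁' := by omega
    obtain rfl := Nat.eq_of_mul_eq_mul_right hd₁ (hs.trans hc')
    exact ⟨rfl, by omega, rfl, rfl⟩

section Congr

variable (hQ : Q.Valid) (hQ' : Q'.Valid) (ho : Q.order = Q'.order) (hs : Q.size = Q'.size)
  (hd : Q.d₁ * Q.d₂ = Q'.d₁ * Q'.d₂) (k : ℕ) (t : ℝ)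
include hQ hQ' ho hs hd

theorem diag_mul_diag_congr :
    Q.diag₁ k t * Q.diag₂ k t = Q'.diag₁ k t * Q'.diag₂ k t := by
  rcases eq_or_swap_or_zero hQ hQ' ho hs hd with rfl | rfl | ⟨h1, h2, h3, h4⟩
  · rfl
  · unfold diag₁ diag₂
    ring
  · simp only [diag₁, diag₂, h1, h2, h3, h4]

theorem disc_congr : Q.disc k t = Q'.disc k t := by
  have : (Q.d₁ * Q.d₂ : ℝ) = Q'.d₁ * Q'.d₂ := by exact_mod_cast hd
  rw [disc, disc, diag_mul_diag_congr hQ hQ' ho hs hd, this]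

theorem mass_congr : Q.mass k t = Q'.mass k t := by
  rcases eq_or_swap_or_zero hQ hQ' ho hs hd with rfl | rfl | ⟨h1, h2, h3, h4⟩
  · rfl
  · unfold mass diag₁ diag₂
    ring
  · have : (Q.n₁ + Q.n₂ : ℝ) = Q'.n₁ + Q'.n₂ := by exact_mod_cast ho
    simp only [mass, diag₁, diag₂, h1, h2, h3, h4, ← add_mul, this]

theorem diag_pow_congr :
    Q.diag₁ k t ^ Q.n₁ * Q.diag₂ k t ^ Q.n₂ = Q'.diag₁ k t ^ Q'.n₁ * Q'.diag₂ k t ^ Q'.n₂ := by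
  rcases eq_or_swap_or_zero hQ hQ' ho hs hd with rfl | rfl | ⟨h1, h2, h3, h4⟩
  · rfl
  · unfold diag₁ diag₂
    ring
  · unfold order at ho
    simp only [diag₁, diag₂, h1, h2, h3, h4, ← pow_add, ho]

end Congr

theorem leadingCoeff_eq_of_forall {k l k' l' : ℝ} {c₀ c₁ c₂ c₃ b₀ c₀' c₁' c₂' c₃' b₀' : ℝ}
    (h : ∀ t : ℝ, 1 < t → (c₀ + c₁ * t + c₂ * t ^ 2 + c₃ * t ^ 3 + k * t ^ 4) * (b₀' + l' * t)
      = (c₀' + c₁' * t + c₂' * t ^ 2 + c₃' * t ^ 3 + k' * t ^ 4) * (b₀ + l * t)) :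
    k * l' = k' * l := by
  -- The fifth finite difference over 2, ..., 7 kills degrees below five and multiplies the
  -- coefficient of $t^5$ by $5!=120$.
  linear_combination (h 7 (by norm_num) - 5 * h 6 (by norm_num) + 10 * h 5 (by norm_num)
    - 10 * h 4 (by norm_num) + 5 * h 3 (by norm_num) - h 2 (by norm_num)) / 120

theorem exists_evenPart_eq (P Q : SemiregularType) : ∃ c₀ c₁ c₂ c₃ : ℝ, ∀ t,
    P.evenPart Q t = c₀ + c₁ * t + c₂ * t ^ 2 + c₃ * t ^ 3
      + P.discCoeff Q.order * Q.discCoeff P.order * t ^ 4 := by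
  set δ : ℝ := P.d₁ + P.d₂ + 2 * (Q.order - 1) - P.d₁ * P.d₂ with hδ
  set ε : ℝ := Q.d₁ + Q.d₂ + 2 * (P.order - 1) - Q.d₁ * Q.d₂ with hε
  refine ⟨1, δ + ε - P.order * Q.order,
    P.discCoeff Q.order + Q.discCoeff P.order + δ * ε - P.order * Q.massCoeff P.order
      - Q.order * P.massCoeff Q.order - 4 * (P.size * Q.size),
    δ * Q.discCoeff P.order + ε * P.discCoeff Q.order
      - P.massCoeff Q.order * Q.massCoeff P.order, fun t => ?_⟩
  rw [evenPart, disc_eq, disc_eq, mass_eq, mass_eq, ← hδ, ← hε]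
  ring

theorem oddPart_eq (P Q : SemiregularType) (t : ℝ) :
    P.oddPart Q t = (P.order * Q.size + Q.order * P.size)
      + (P.massCoeff Q.order * Q.size + Q.massCoeff P.order * P.size) * t := by
  rw [oddPart, mass_eq, mass_eq]
  ring

/-- The coefficients of $t^5$ give one equation. Once the degree sums are eliminated through
$sm=Ne$, it becomes the difference of the degree products times a factor that is positive by
`two_mul_size_lt_massCoeff`. -/
theorem degree_prod_eq (hP : P.Valid) (hQ : Q.Valid) (hQ' : Q'.Valid) (ho : Q.order = Q'.order)
    (hs : Q.size = Q'.size) (h0 : Q.size ≠ 0)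
    (h : ∀ t, 1 < t → P.evenPart Q t * P.oddPart Q' t = P.evenPart Q' t * P.oddPart Q t) :
    Q.d₁ * Q.d₂ = Q'.d₁ * Q'.d₂ := by
  obtain ⟨c₀, c₁, c₂, c₃, hc⟩ := exists_evenPart_eq P Q
  obtain ⟨c₀', c₁', c₂', c₃', hc'⟩ := exists_evenPart_eq P Q'
  simp only [hc, hc', oddPart_eq] at h
  have hlead := leadingCoeff_eq_of_forall h
  rw [← ho, ← hs] at hlead
  have hα : P.discCoeff Q.order ≠ 0 := by
    have h1 : (2 : ℝ) ≤ Q.order := by exact_mod_cast hQ.two_le_order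
    have h2 : (0 : ℝ) ≤ P.d₁ := Nat.cast_nonneg _
    have h3 : (0 : ℝ) ≤ P.d₂ := Nat.cast_nonneg _
    exact (mul_pos (by linarith) (by linarith)).ne'
  have hlead' : Q.discCoeff P.order
        * (P.massCoeff Q.order * Q.size + Q'.massCoeff P.order * P.size)
      = Q'.discCoeff P.order
        * (P.massCoeff Q.order * Q.size + Q.massCoeff P.order * P.size) :=
    mul_left_cancel₀ hα (by linear_combination hlead)
  have hβ := hP.two_mul_size_lt_massCoeff hQ.two_le_order
  set β := P.massCoeff Q.order
  have hmass : ∀ R : SemiregularType, R.Valid →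
      R.massCoeff P.order = (P.order - 1) * R.order + R.order * (R.d₁ + R.d₂) - 2 * R.size := by
    intro R hR
    have : (R.n₁ : ℝ) * R.d₁ = R.n₂ * R.d₂ := by exact_mod_cast hR.count
    unfold massCoeff order size
    push_cast
    linear_combination this
  have hdisc : ∀ R : SemiregularType, R.discCoeff P.order
      = R.d₁ * R.d₂ + (R.d₁ + R.d₂) * (P.order - 1) + (P.order - 1) ^ 2 := by
    intro R
    unfold discCoeff
    ring
  have hsum : ((Q.d₁ + Q.d₂ : ℝ)) * Q.size = Q.order * (Q.d₁ * Q.d₂) := by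
    exact_mod_cast hQ.degree_sum_mul_size
  have hsum' : ((Q'.d₁ + Q'.d₂ : ℝ)) * Q.size = Q.order * (Q'.d₁ * Q'.d₂) := by
    rw [hs, ho]
    exact_mod_cast hQ'.degree_sum_mul_size
  rw [hmass Q hQ, hmass Q' hQ', hdisc, hdisc, ← ho, ← hs] at hlead'
  have hr : (1 : ℝ) ≤ (P.order : ℝ) - 1 := by
    have : (2 : ℝ) ≤ P.order := by exact_mod_cast hP.two_le_order
    linarith
  have hN : (2 : ℝ) ≤ Q.order := by exact_mod_cast hQ.two_le_order
  have hm : (0 : ℝ) < Q.size := by exact_mod_cast Nat.pos_of_ne_zero h0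
  have hσ : (0 : ℝ) ≤ P.size := Nat.cast_nonneg _
  set r : ℝ := (P.order : ℝ) - 1
  set N : ℝ := (Q.order : ℝ)
  set m : ℝ := (Q.size : ℝ)
  set σ : ℝ := (P.size : ℝ)
  set s : ℝ := (Q.d₁ + Q.d₂ : ℝ)
  set s' : ℝ := (Q'.d₁ + Q'.d₂ : ℝ)
  set e : ℝ := (Q.d₁ * Q.d₂ : ℝ)
  set e' : ℝ := (Q'.d₁ * Q'.d₂ : ℝ)
  have hs1 : s = N * e / m := by field_simp; linarith
  have hs2 : s' = N * e' / m := by field_simp; linarith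
  have hfin : (e - e') * (N * r * (β - σ) + m * (β - 2 * σ)) = 0 := by
    rw [hs1, hs2] at hlead'
    field_simp at hlead'
    refine mul_left_cancel₀ (pow_ne_zero 2 hm.ne') ?_
    linear_combination hlead'
  have hpos : 0 < N * r * (β - σ) + m * (β - 2 * σ) := by
    have h1 : 0 < N * r := mul_pos (by linarith) (by linarith)
    have h2 : 0 < β - σ := by linarith
    have h3 : 0 < β - 2 * σ := by linarith
    positivity
  have := (mul_eq_zero.mp hfin).resolve_right hpos.ne'
  have he : (Q.d₁ : ℝ) * Q.d₂ = Q'.d₁ * Q'.d₂ := sub_eq_zero.mp this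
  exact_mod_cast he

end SemiregularType

/-- Both exponents are the order of vanishing at $u=1$: after cancelling the smaller power,
continuity extends the identity to $u=1$, where a surplus factor would force `F 1 = 0`. -/
theorem exponent_eq_of_forall_mul_eq {F F' : ℝ → ℂ} (hF : Continuous F) (hF' : Continuous F')
    (h1 : F 1 ≠ 0) (h1' : F' 1 ≠ 0) {a b : ℕ}
    (h : ∀ u : ℝ, 1 < u → ((1 - u ^ 2 : ℝ) : ℂ) ^ a * F u = ((1 - u ^ 2 : ℝ) : ℂ) ^ b * F' u) :
    a = b := by
  wlog hab : a ≤ b generalizing a b F F'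
  · exact (this hF' hF h1' h1 (fun u hu => (h u hu).symm) (le_of_not_ge hab)).symm
  by_contra hne
  obtain ⟨k, rfl⟩ : ∃ k, b = a + (k + 1) := ⟨b - a - 1, by omega⟩
  have hclosed : IsClosed {u : ℝ | F u = ((1 - u ^ 2 : ℝ) : ℂ) ^ (k + 1) * F' u} :=
    isClosed_eq hF (by fun_prop)
  have hsub : Set.Ioi (1 : ℝ) ⊆ {u : ℝ | F u = ((1 - u ^ 2 : ℝ) : ℂ) ^ (k + 1) * F' u} := by
    intro u hu
    have hu' : (1 : ℝ) < u := hu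
    have hc : ((1 - u ^ 2 : ℝ) : ℂ) ≠ 0 := by
      have : (1 - u ^ 2 : ℝ) ≠ 0 := by nlinarith
      exact_mod_cast this
    have := h u hu'
    rw [pow_add, mul_assoc] at this
    exact mul_left_cancel₀ (pow_ne_zero _ hc) this
  have := hclosed.closure_subset_iff.mpr hsub
  rw [closure_Ioi] at this
  have h2 : F 1 = ((1 - (1 : ℝ) ^ 2 : ℝ) : ℂ) ^ (k + 1) * F' 1 := this Set.self_mem_Ici
  apply h1
  rw [h2]
  simp

/-! ### Recovering the characteristic polynomial from a block -/

namespace Matrix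

variable {W W' : Type*} [Fintype W] [DecidableEq W] [Fintype W'] [DecidableEq W']

theorem IsSemiregular.charpoly_eq_X_pow {M : Matrix W W ℂ} {T : Finset W} {p q : ℕ}
    (hM : M.IsSemiregular T p q) (h : (semiregularType T p q).size = 0) :
    M.charpoly = Polynomial.X ^ Fintype.card W := by
  rw [(hM.eq_zero_of_mul_eq_zero h).2.2, charpoly_zero]

variable {M : Matrix W W ℂ} {M' : Matrix W' W' ℂ} {T : Finset W} {T' : Finset W'}
  {p q p' q' k : ℕ}

/-- Under the numerical hypotheses both blocks are the same nonzero prefactor times the respective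
characteristic polynomial at the same point $\sqrt{ab}/u$, with $a,b$ the diagonal values. -/
theorem iharaBlock_eq_iff (hM : M.IsSemiregular T p q) (hM' : M'.IsSemiregular T' p' q')
    (hk : 2 ≤ k) (hW : Fintype.card W = Fintype.card W')
    (hs : (semiregularType T p q).size = (semiregularType T' p' q').size)
    (hd : p * q = p' * q') :
    (∀ u : ℝ, 1 < u → iharaBlock M T p q k u = iharaBlock M' T' p' q' k u)
      ↔ M.charpoly = M'.charpoly := by
  have ho : (semiregularType T p q).order = (semiregularType T' p' q').order := by
    rw [IsSemiregular.order_semiregularType, IsSemiregular.order_semiregularType, hW]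
  set Q := semiregularType T p q with hQ
  set Q' := semiregularType T' p' q' with hQ'
  have hd' : Q.d₁ * Q.d₂ = Q'.d₁ * Q'.d₂ := hd
  have hk1 : 1 ≤ k := by omega
  have hdiag := SemiregularType.diag_mul_diag_congr hM.valid hM'.valid ho hs hd' k
  have hpow := SemiregularType.diag_pow_congr hM.valid hM'.valid ho hs hd' k
  set x : ℝ → ℝ := fun u => √(Q'.diag₁ k (u ^ 2) * Q'.diag₂ k (u ^ 2)) with hx
  have h1 : ∀ u : ℝ, 1 < u → iharaBlock M T p q k u
      = ((Q'.diag₁ k (u ^ 2) ^ Q'.n₁ * Q'.diag₂ k (u ^ 2) ^ Q'.n₂ : ℝ) : ℂ)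
        * ((u / x u : ℝ) : ℂ) ^ Fintype.card W' * M.charpoly.eval ((x u / u : ℝ) : ℂ) := by
    intro u hu
    rw [hM.iharaBlock_eq hk1 (by linarith), ← hQ, hpow, hdiag, hW]
  have h2 : ∀ u : ℝ, 1 < u → iharaBlock M' T' p' q' k u
      = ((Q'.diag₁ k (u ^ 2) ^ Q'.n₁ * Q'.diag₂ k (u ^ 2) ^ Q'.n₂ : ℝ) : ℂ)
        * ((u / x u : ℝ) : ℂ) ^ Fintype.card W' * M'.charpoly.eval ((x u / u : ℝ) : ℂ) := by
    intro u hu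
    rw [hM'.iharaBlock_eq hk1 (by linarith)]
  constructor
  · intro h
    -- For $k\ge 2$ both diagonal values are at least $u^2$, so the evaluation points are unbounded
    -- and in particular infinite in number.
    have hle : ∀ u : ℝ, 1 < u → u ≤ x u / u := by
      intro u hu
      have hu0 : 0 < u := by linarith
      have hk' : (2 : ℝ) ≤ k := by exact_mod_cast hk
      have ha : u ^ 2 ≤ Q'.diag₁ k (u ^ 2) := by
        have : (0 : ℝ) ≤ Q'.d₁ := Nat.cast_nonneg _
        unfold SemiregularType.diag₁
        nlinarith [mul_nonneg (sq_nonneg u) (by linarith : (0 : ℝ) ≤ Q'.d₁ + k - 2)]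
      have hb : u ^ 2 ≤ Q'.diag₂ k (u ^ 2) := by
        have : (0 : ℝ) ≤ Q'.d₂ := Nat.cast_nonneg _
        unfold SemiregularType.diag₂
        nlinarith [mul_nonneg (sq_nonneg u) (by linarith : (0 : ℝ) ≤ Q'.d₂ + k - 2)]
      rw [le_div_iff₀ hu0]
      refine Real.le_sqrt_of_sq_le ?_
      calc (u * u) ^ 2 = u ^ 2 * u ^ 2 := by ring
        _ ≤ _ := mul_le_mul ha hb (sq_nonneg u) ((sq_nonneg u).trans ha)
    have hinf : ((fun u : ℝ => x u / u) '' Set.Ioi 1).Infinite := by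
      refine Set.infinite_of_not_bddAbove ?_
      rintro ⟨B, hB⟩
      have hu : (1 : ℝ) < max B 1 + 1 := by linarith [le_max_right B 1]
      have := hB ⟨max B 1 + 1, hu, rfl⟩
      have := hle _ hu
      linarith [le_max_left B 1]
    refine Polynomial.eq_of_infinite_eval_eq _ _ ((hinf.image
      (Complex.ofReal_injective.injOn)).mono ?_)
    rintro _ ⟨_, ⟨u, hu, rfl⟩, rfl⟩
    have hu' : (1 : ℝ) < u := hu
    have hne := hM'.iharaBlock_ne_zero hk1 (hu'.le.trans (le_abs_self u))
    have hEq := h u hu'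
    rw [h1 u hu', h2 u hu'] at hEq
    rw [h2 u hu'] at hne
    exact mul_left_cancel₀ (left_ne_zero_of_mul hne) hEq
  · intro h u hu
    rw [h1 u hu, h2 u hu, h]

end Matrix

/-! ### What the zeta function of a join determines -/

namespace OrientedEdgeGraph

open Matrix

variable {V W W' D E E' : Type*} [Fintype V] [DecidableEq V] [Fintype W] [DecidableEq W]
  [Fintype W'] [DecidableEq W'] [Fintype D] [Fintype E] [Fintype E']

section Parts

variable [DecidableEq D] [DecidableEq E]
  {G : OrientedEdgeGraph V D} {H : OrientedEdgeGraph W E} {S : Finset V} {T : Finset W}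
  {p q r s : ℕ}

theorem ihara_join_parts
    (hG : G.adjMatrix.IsSemiregular S p q) (hH : H.adjMatrix.IsSemiregular T r s)
    (hGd : ∀ v, (G.degree v : ℂ) = S.twoValued (p : ℂ) q v)
    (hHd : ∀ v, (H.degree v : ℂ) = T.twoValued (r : ℂ) s v)
    {m : ℕ} (hm : Fintype.card ((D ⊕ E) ⊕ (V × W ⊕ W × V)) = 2 * m) {u : ℝ} (hu : 1 < u) :
    ((1 - u ^ 2 : ℝ) : ℂ) ^ (Fintype.card V + Fintype.card W)
        * ((ofRel (G.join H).Follows).charpolyRev.eval (-(u : ℂ))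
          - (ofRel (G.join H).Follows).charpolyRev.eval (u : ℂ))
        * (((semiregularType S p q).disc (Fintype.card W) (u ^ 2)
          * (semiregularType T r s).disc (Fintype.card V) (u ^ 2) : ℝ) : ℂ)
      = ((1 - u ^ 2 : ℝ) : ℂ) ^ m
        * (iharaBlock G.adjMatrix S p q (Fintype.card W) u
          * iharaBlock H.adjMatrix T r s (Fintype.card V) u)
        * ((4 * u ^ 3 * (semiregularType S p q).oddPart (semiregularType T r s) (u ^ 2) : ℝ) : ℂ) ∧
    ((1 - u ^ 2 : ℝ) : ℂ) ^ (Fintype.card V + Fintype.card W)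
        * ((ofRel (G.join H).Follows).charpolyRev.eval (-(u : ℂ))
          + (ofRel (G.join H).Follows).charpolyRev.eval (u : ℂ))
        * (((semiregularType S p q).disc (Fintype.card W) (u ^ 2)
          * (semiregularType T r s).disc (Fintype.card V) (u ^ 2) : ℝ) : ℂ)
      = ((1 - u ^ 2 : ℝ) : ℂ) ^ m
        * (iharaBlock G.adjMatrix S p q (Fintype.card W) u
          * iharaBlock H.adjMatrix T r s (Fintype.card V) u)
        * ((2 * (semiregularType S p q).evenPart (semiregularType T r s) (u ^ 2) : ℝ) : ℂ) := by
  have h1 := ihara_join G H hG hH hGd hHd hm (u := u) (hu.trans_le (le_abs_self u))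
  have h2 := ihara_join G H hG hH hGd hHd hm (u := -u) (by rw [abs_neg]; exact hu.trans_le (le_abs_self u))
  rw [neg_sq, hG.iharaBlock_neg, hH.iharaBlock_neg] at h2
  simp only [SemiregularType.oddPart, SemiregularType.evenPart,
    IsSemiregular.order_semiregularType]
  push_cast at h1 h2 ⊢
  constructor
  · linear_combination h2 - h1
  · linear_combination h2 + h1

theorem natDegree_charpolyRev_join
    (hG : G.adjMatrix.IsSemiregular S p q) (hH : H.adjMatrix.IsSemiregular T r s) :
    (ofRel (G.join H).Follows).charpolyRev.natDegree
      = Fintype.card ((D ⊕ E) ⊕ (V × W ⊕ W × V)) := by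
  refine natDegree_charpolyRev_of_det_ne_zero _ (det_ofRel_follows_ne_zero _ ?_)
  have hV := hG.valid.two_le_order
  have hW := hH.valid.two_le_order
  rw [IsSemiregular.order_semiregularType] at hV hW
  rintro (v | w)
  · rw [degree_join_inl]
    omega
  · rw [degree_join_inr]
    omega

end Parts

variable {G : OrientedEdgeGraph V D} {H : OrientedEdgeGraph W E} {H' : OrientedEdgeGraph W' E'}
  {S : Finset V} {T : Finset W} {T' : Finset W'} {p q r s r' s' : ℕ}

theorem charpolyRev_join_eq_iff [DecidableEq D] [DecidableEq E] [DecidableEq E']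
    (hG : G.adjMatrix.IsSemiregular S p q) (hH : H.adjMatrix.IsSemiregular T r s)
    (hH' : H'.adjMatrix.IsSemiregular T' r' s')
    (hGd : ∀ v, (G.degree v : ℂ) = S.twoValued (p : ℂ) q v)
    (hHd : ∀ v, (H.degree v : ℂ) = T.twoValued (r : ℂ) s v)
    (hHd' : ∀ v, (H'.degree v : ℂ) = T'.twoValued (r' : ℂ) s' v)
    (hD : Fintype.card D = 2 * (semiregularType S p q).size)
    (hE : Fintype.card E = 2 * (semiregularType T r s).size)
    (hE' : Fintype.card E' = 2 * (semiregularType T' r' s').size) :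
    (ofRel (G.join H).Follows).charpolyRev = (ofRel (G.join H').Follows).charpolyRev ↔
      Fintype.card W = Fintype.card W' ∧
      (semiregularType T r s).size = (semiregularType T' r' s').size ∧ r * s = r' * s' ∧
      H.adjMatrix.charpoly = H'.adjMatrix.charpoly := by
  set P := semiregularType S p q with hP
  set Q := semiregularType T r s with hQ
  set Q' := semiregularType T' r' s' with hQ'
  have hVo : P.order = Fintype.card V := IsSemiregular.order_semiregularType
  have hWo : Q.order = Fintype.card W := IsSemiregular.order_semiregularType
  have hWo' : Q'.order = Fintype.card W' := IsSemiregular.order_semiregularType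
  have hV : 2 ≤ Fintype.card V := hVo ▸ hG.valid.two_le_order
  have hW : 2 ≤ Fintype.card W := hWo ▸ hH.valid.two_le_order
  have hW' : 2 ≤ Fintype.card W' := hWo' ▸ hH'.valid.two_le_order
  have hm : Fintype.card ((D ⊕ E) ⊕ (V × W ⊕ W × V))
      = 2 * (P.size + Q.size + Fintype.card V * Fintype.card W) := by
    simp only [Fintype.card_sum, Fintype.card_prod, hD, hE]
    ring
  have hm' : Fintype.card ((D ⊕ E') ⊕ (V × W' ⊕ W' × V))
      = 2 * (P.size + Q'.size + Fintype.card V * Fintype.card W') := by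
    simp only [Fintype.card_sum, Fintype.card_prod, hD, hE']
    ring
  have hc : ∀ u : ℝ, 1 < u → ((1 - u ^ 2 : ℝ) : ℂ) ≠ 0 := by
    intro u hu
    have : (1 - u ^ 2 : ℝ) ≠ 0 := by nlinarith
    exact_mod_cast this
  have habs : ∀ u : ℝ, 1 ≤ u → 1 ≤ |u| := fun u hu => hu.trans (le_abs_self u)
  have hdisc : ∀ (R : SemiregularType) (k : ℕ) (u : ℝ), 2 ≤ k → 1 ≤ u →
      ((R.disc k (u ^ 2) : ℝ) : ℂ) ≠ 0 := fun R k u hk hu => by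
    exact_mod_cast (R.disc_pos (by omega) (habs u hu)).ne'
  have hblockG : ∀ (k : ℕ) (u : ℝ), 2 ≤ k → 1 ≤ u → iharaBlock G.adjMatrix S p q k u ≠ 0 :=
    fun k u hk hu => hG.iharaBlock_ne_zero (by omega) (habs u hu)
  have hblockH : ∀ u : ℝ, 1 ≤ u → iharaBlock H.adjMatrix T r s (Fintype.card V) u ≠ 0 :=
    fun u hu => hH.iharaBlock_ne_zero (by omega) (habs u hu)
  have hblockH' : ∀ u : ℝ, 1 ≤ u → iharaBlock H'.adjMatrix T' r' s' (Fintype.card V) u ≠ 0 :=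
    fun u hu => hH'.iharaBlock_ne_zero (by omega) (habs u hu)
  constructor
  · intro hf
    -- The degree of the zeta polynomial is the number of oriented edges, since every vertex of the
    -- join has degree at least two.
    have hmm : P.size + Q.size + Fintype.card V * Fintype.card W
        = P.size + Q'.size + Fintype.card V * Fintype.card W' := by
      have := congrArg Polynomial.natDegree hf
      rw [natDegree_charpolyRev_join hG hH, natDegree_charpolyRev_join hG hH', hm, hm'] at this
      omega
    rw [← hmm] at hm'
    -- Elimination of the common value `f` from the two formulas; it is applied to the odd and to
    -- the even part of the same polynomial.
    have hparts : ∀ u : ℝ, 1 < u → ∀ f : ℂ, ∀ x x' : ℂ,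
        ((1 - u ^ 2 : ℝ) : ℂ) ^ (Fintype.card V + Fintype.card W) * f
            * ((P.disc (Fintype.card W) (u ^ 2) * Q.disc (Fintype.card V) (u ^ 2) : ℝ) : ℂ)
          = ((1 - u ^ 2 : ℝ) : ℂ) ^ (P.size + Q.size + Fintype.card V * Fintype.card W)
            * (iharaBlock G.adjMatrix S p q (Fintype.card W) u
              * iharaBlock H.adjMatrix T r s (Fintype.card V) u) * x →
        ((1 - u ^ 2 : ℝ) : ℂ) ^ (Fintype.card V + Fintype.card W') * f
            * ((P.disc (Fintype.card W') (u ^ 2) * Q'.disc (Fintype.card V) (u ^ 2) : ℝ) : ℂ)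
          = ((1 - u ^ 2 : ℝ) : ℂ) ^ (P.size + Q.size + Fintype.card V * Fintype.card W)
            * (iharaBlock G.adjMatrix S p q (Fintype.card W') u
              * iharaBlock H'.adjMatrix T' r' s' (Fintype.card V) u) * x' →
        ((1 - u ^ 2 : ℝ) : ℂ) ^ Fintype.card W'
            * (((P.disc (Fintype.card W') (u ^ 2) * Q'.disc (Fintype.card V) (u ^ 2) : ℝ) : ℂ)
              * (iharaBlock G.adjMatrix S p q (Fintype.card W) u
              * iharaBlock H.adjMatrix T r s (Fintype.card V) u) * x)
          = ((1 - u ^ 2 : ℝ) : ℂ) ^ Fintype.card W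
            * (((P.disc (Fintype.card W) (u ^ 2) * Q.disc (Fintype.card V) (u ^ 2) : ℝ) : ℂ)
              * (iharaBlock G.adjMatrix S p q (Fintype.card W') u
              * iharaBlock H'.adjMatrix T' r' s' (Fintype.card V) u) * x') := by
      intro u hu f x x' h1 h2
      have h3 := pow_ne_zero (P.size + Q.size + Fintype.card V * Fintype.card W) (hc u hu)
      refine mul_left_cancel₀ (mul_ne_zero h3 (pow_ne_zero (Fintype.card V) (hc u hu))) ?_
      rw [pow_add _ (Fintype.card V) (Fintype.card W)] at h1
      rw [pow_add _ (Fintype.card V) (Fintype.card W')] at h2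
      generalize ((1 - u ^ 2 : ℝ) : ℂ) ^ (P.size + Q.size + Fintype.card V * Fintype.card W) = a
        at *
      generalize ((1 - u ^ 2 : ℝ) : ℂ) ^ Fintype.card V = b at *
      generalize ((1 - u ^ 2 : ℝ) : ℂ) ^ Fintype.card W = c at *
      generalize ((1 - u ^ 2 : ℝ) : ℂ) ^ Fintype.card W' = d at *
      generalize ((P.disc (Fintype.card W) (u ^ 2) * Q.disc (Fintype.card V) (u ^ 2) : ℝ) : ℂ) = e
        at *
      generalize ((P.disc (Fintype.card W') (u ^ 2) * Q'.disc (Fintype.card V) (u ^ 2) : ℝ) : ℂ) = e'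
        at *
      linear_combination b * c * e * h2 - b * d * e' * h1
    have hodd : ∀ u : ℝ, 1 < u →
        ((1 - u ^ 2 : ℝ) : ℂ) ^ Fintype.card W'
            * (((P.disc (Fintype.card W') (u ^ 2) * Q'.disc (Fintype.card V) (u ^ 2) : ℝ) : ℂ)
              * (iharaBlock G.adjMatrix S p q (Fintype.card W) u
              * iharaBlock H.adjMatrix T r s (Fintype.card V) u)
              * ((4 * u ^ 3 * P.oddPart Q (u ^ 2) : ℝ) : ℂ))
          = ((1 - u ^ 2 : ℝ) : ℂ) ^ Fintype.card W
            * (((P.disc (Fintype.card W) (u ^ 2) * Q.disc (Fintype.card V) (u ^ 2) : ℝ) : ℂ)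
              * (iharaBlock G.adjMatrix S p q (Fintype.card W') u
              * iharaBlock H'.adjMatrix T' r' s' (Fintype.card V) u)
              * ((4 * u ^ 3 * P.oddPart Q' (u ^ 2) : ℝ) : ℂ)) := fun u hu =>
      hparts u hu _ _ _ (ihara_join_parts hG hH hGd hHd hm hu).1
        (hf ▸ (ihara_join_parts hG hH' hGd hHd' hm' hu).1)
    have heven : ∀ u : ℝ, 1 < u →
        ((1 - u ^ 2 : ℝ) : ℂ) ^ Fintype.card W'
            * (((P.disc (Fintype.card W') (u ^ 2) * Q'.disc (Fintype.card V) (u ^ 2) : ℝ) : ℂ)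
              * (iharaBlock G.adjMatrix S p q (Fintype.card W) u
              * iharaBlock H.adjMatrix T r s (Fintype.card V) u)
              * ((2 * P.evenPart Q (u ^ 2) : ℝ) : ℂ))
          = ((1 - u ^ 2 : ℝ) : ℂ) ^ Fintype.card W
            * (((P.disc (Fintype.card W) (u ^ 2) * Q.disc (Fintype.card V) (u ^ 2) : ℝ) : ℂ)
              * (iharaBlock G.adjMatrix S p q (Fintype.card W') u
              * iharaBlock H'.adjMatrix T' r' s' (Fintype.card V) u)
              * ((2 * P.evenPart Q' (u ^ 2) : ℝ) : ℂ)) := fun u hu =>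
      hparts u hu _ _ _ (ihara_join_parts hG hH hGd hHd hm hu).2
        (hf ▸ (ihara_join_parts hG hH' hGd hHd' hm' hu).2)
    have hzero : Fintype.card W = Fintype.card W' → Q.size = 0 → Q'.size = 0 →
        Fintype.card W = Fintype.card W' ∧ Q.size = Q'.size ∧ r * s = r' * s' ∧
          H.adjMatrix.charpoly = H'.adjMatrix.charpoly := by
      intro h1 h2 h3
      have h4 : r = 0 := (hH.valid.degrees_eq_zero h2).1
      have h5 : r' = 0 := (hH'.valid.degrees_eq_zero h3).1
      exact ⟨h1, h2.trans h3.symm, by rw [h4, h5, zero_mul, zero_mul],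
        by rw [hH.charpoly_eq_X_pow h2, hH'.charpoly_eq_X_pow h3, h1]⟩
    have hL : ∀ R : SemiregularType, R.Valid → ¬(P.size = 0 ∧ R.size = 0) → ∀ t : ℝ, 0 ≤ t →
        P.oddPart R t ≠ 0 := by
      intro R hR h t ht
      have h1 := SemiregularType.mass_pos hG.valid (k := R.order)
        (by have := hR.two_le_order; omega) ht
      have h2 := SemiregularType.mass_pos hR (k := P.order) (by omega) ht
      have h3 : (0 : ℝ) ≤ P.size := Nat.cast_nonneg _
      have h4 : (0 : ℝ) ≤ R.size := Nat.cast_nonneg _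
      unfold SemiregularType.oddPart
      rw [not_and_or] at h
      rcases h with h | h
      · have : (0 : ℝ) < P.size := by exact_mod_cast Nat.pos_of_ne_zero h
        positivity
      · have : (0 : ℝ) < R.size := by exact_mod_cast Nat.pos_of_ne_zero h
        positivity
    have hL0 : ∀ R : SemiregularType, P.size = 0 ∧ R.size = 0 → ∀ t, P.oddPart R t = 0 := by
      rintro R ⟨h1, h2⟩ t
      simp [SemiregularType.oddPart, h1, h2]
    have hfac : ∀ u : ℝ, 1 ≤ u →
        ((P.disc (Fintype.card W') (u ^ 2) * Q'.disc (Fintype.card V) (u ^ 2) : ℝ) : ℂ)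
              * (iharaBlock G.adjMatrix S p q (Fintype.card W) u
              * iharaBlock H.adjMatrix T r s (Fintype.card V) u) ≠ 0 := by
      intro u hu
      rw [Complex.ofReal_mul]
      exact mul_ne_zero (mul_ne_zero (hdisc _ _ _ hW' hu) (hdisc _ _ _ hV hu))
        (mul_ne_zero (hblockG _ _ hW hu) (hblockH _ hu))
    have hfac' : ∀ u : ℝ, 1 ≤ u →
        ((P.disc (Fintype.card W) (u ^ 2) * Q.disc (Fintype.card V) (u ^ 2) : ℝ) : ℂ)
              * (iharaBlock G.adjMatrix S p q (Fintype.card W') u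
              * iharaBlock H'.adjMatrix T' r' s' (Fintype.card V) u) ≠ 0 := by
      intro u hu
      rw [Complex.ofReal_mul]
      exact mul_ne_zero (mul_ne_zero (hdisc _ _ _ hW hu) (hdisc _ _ _ hV hu))
        (mul_ne_zero (hblockG _ _ hW' hu) (hblockH' _ hu))
    -- The odd part vanishes exactly when neither factor of the join has edges; testing at $u=2$
    -- suffices.
    have hiff : (P.size = 0 ∧ Q.size = 0) ↔ (P.size = 0 ∧ Q'.size = 0) := by
      have h2 := hodd 2 one_lt_two
      constructor
      · intro h
        by_contra hcon
        rw [hL0 Q h, mul_zero, Complex.ofReal_zero, mul_zero, mul_zero, eq_comm] at h2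
        refine mul_ne_zero (pow_ne_zero _ (hc 2 one_lt_two)) (mul_ne_zero (hfac' 2 one_le_two) ?_) h2
        have := hL Q' hH'.valid hcon (2 ^ 2) (by norm_num)
        exact_mod_cast mul_ne_zero (by norm_num : (4 * 2 ^ 3 : ℝ) ≠ 0) this
      · intro h
        by_contra hcon
        rw [hL0 Q' h, mul_zero, Complex.ofReal_zero, mul_zero, mul_zero] at h2
        refine mul_ne_zero (pow_ne_zero _ (hc 2 one_lt_two)) (mul_ne_zero (hfac 2 one_le_two) ?_) h2
        have := hL Q hH.valid hcon (2 ^ 2) (by norm_num)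
        exact_mod_cast mul_ne_zero (by norm_num : (4 * 2 ^ 3 : ℝ) ≠ 0) this
    have hVpos : 0 < Fintype.card V := by omega
    by_cases hPQ : P.size = 0 ∧ Q.size = 0
    · have hQ0' := (hiff.mp hPQ).2
      -- Both joins are now complete bipartite, and their edge counts `|V||W|` and `|V||W'|` agree.
      refine hzero ?_ hPQ.2 hQ0'
      rw [hPQ.2, hQ0'] at hmm
      exact Nat.eq_of_mul_eq_mul_left hVpos (by omega)
    have hPQ' := mt hiff.mpr hPQ
    have hdc : ∀ (R : SemiregularType) (k : ℕ), Continuous fun u : ℝ => R.disc k (u ^ 2) := by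
      intro R k
      simp only [SemiregularType.disc_eq]
      fun_prop
    have hlc : ∀ R : SemiregularType, Continuous fun u : ℝ => 4 * u ^ 3 * P.oddPart R (u ^ 2) := by
      intro R
      simp only [SemiregularType.oddPart_eq]
      fun_prop
    have hl1 : ∀ R : SemiregularType, R.Valid → ¬(P.size = 0 ∧ R.size = 0) → ∀ u : ℝ, 1 ≤ u →
        ((4 * u ^ 3 * P.oddPart R (u ^ 2) : ℝ) : ℂ) ≠ 0 := by
      intro R hR h u hu
      have h1 := hL R hR h (u ^ 2) (sq_nonneg u)
      have h2 : 4 * u ^ 3 ≠ 0 := by positivity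
      exact_mod_cast mul_ne_zero h2 h1
    have hWW : Fintype.card W = Fintype.card W' := by
      refine (exponent_eq_of_forall_mul_eq ?_ ?_ ?_ ?_ hodd).symm
      · exact ((Complex.continuous_ofReal.comp ((hdc _ _).mul (hdc _ _))).mul
          (IsSemiregular.continuous_iharaBlock.mul IsSemiregular.continuous_iharaBlock)).mul
          (Complex.continuous_ofReal.comp (hlc Q))
      · exact ((Complex.continuous_ofReal.comp ((hdc _ _).mul (hdc _ _))).mul
          (IsSemiregular.continuous_iharaBlock.mul IsSemiregular.continuous_iharaBlock)).mul
          (Complex.continuous_ofReal.comp (hlc Q'))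
      · exact mul_ne_zero (hfac 1 le_rfl) (hl1 Q hH.valid hPQ 1 le_rfl)
      · exact mul_ne_zero (hfac' 1 le_rfl) (hl1 Q' hH'.valid hPQ' 1 le_rfl)
    have hs : Q.size = Q'.size := by
      rw [hWW] at hmm
      omega
    by_cases hQ0 : Q.size = 0
    · exact hzero hWW hQ0 (hs ▸ hQ0)
    have ho : Q.order = Q'.order := by rw [hWo, hWo', hWW]
    -- Cross-multiplying the even and odd identities eliminates all block determinants and
    -- denominators.
    have hratio : ∀ t : ℝ, 1 < t →
        P.evenPart Q t * P.oddPart Q' t = P.evenPart Q' t * P.oddPart Q t := by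
      intro t ht
      have hu : 1 < √t := Real.lt_sqrt_of_sq_lt (by simpa using ht)
      have h1 := hodd _ hu
      have h2 := heven _ hu
      have h3 := mul_ne_zero (pow_ne_zero (Fintype.card W') (hc _ hu)) (hfac _ hu.le)
      have h4 := mul_ne_zero (pow_ne_zero (Fintype.card W) (hc _ hu)) (hfac' _ hu.le)
      rw [← mul_assoc, ← mul_assoc (_ ^ Fintype.card W)] at h1 h2
      have haux : ∀ x y e o e' o' : ℂ, x * e = y * e' → x * o = y * o' →
          x * y * (e * o') = x * y * (e' * o) := by
        intro x y e o e' o' he ho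
        linear_combination (y * o') * he - (y * e') * ho
      have hu3 : (4 * √t ^ 3 : ℝ) ≠ 0 := by positivity
      have hcomplex : ((2 * P.evenPart Q (√t ^ 2) : ℝ) : ℂ)
            * ((4 * √t ^ 3 * P.oddPart Q' (√t ^ 2) : ℝ) : ℂ)
          = ((2 * P.evenPart Q' (√t ^ 2) : ℝ) : ℂ)
            * ((4 * √t ^ 3 * P.oddPart Q (√t ^ 2) : ℝ) : ℂ) := by
        refine mul_left_cancel₀ (mul_ne_zero h3 h4) ?_
        exact haux _ _ _ _ _ _ h2 h1
      rw [Real.sq_sqrt (by linarith)] at hcomplex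
      have hreal : (2 * P.evenPart Q t) * (4 * √t ^ 3 * P.oddPart Q' t)
          = (2 * P.evenPart Q' t) * (4 * √t ^ 3 * P.oddPart Q t) := by
        exact_mod_cast hcomplex
      refine mul_left_cancel₀ hu3 ?_
      linarith
    have hd : r * s = r' * s' :=
      SemiregularType.degree_prod_eq hG.valid hH.valid hH'.valid ho hs hQ0 hratio
    -- Every other factor of the odd identity now agrees and is nonzero, so the blocks of `H` and
    -- `H'` coincide.
    refine ⟨hWW, hs, hd, (iharaBlock_eq_iff hH hH' hV hWW hs hd).mp fun u hu => ?_⟩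
    have h1 := hodd u hu
    have hodd_eq : P.oddPart Q (u ^ 2) = P.oddPart Q' (u ^ 2) := by
      rw [SemiregularType.oddPart, SemiregularType.oddPart,
        SemiregularType.mass_congr hH.valid hH'.valid ho hs hd, ho, hs]
    rw [hodd_eq, SemiregularType.disc_congr hH.valid hH'.valid ho hs hd, hWW] at h1
    have h2 := mul_right_cancel₀ (hl1 Q' hH'.valid hPQ' u hu.le)
      (mul_left_cancel₀ (pow_ne_zero _ (hc u hu)) h1)
    have h3 : ((P.disc (Fintype.card W') (u ^ 2) * Q'.disc (Fintype.card V) (u ^ 2) : ℝ) : ℂ) ≠ 0 := by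
      rw [Complex.ofReal_mul]
      exact mul_ne_zero (hdisc _ _ _ hW' hu.le) (hdisc _ _ _ hV hu.le)
    exact mul_left_cancel₀ (hblockG _ _ hW' hu.le) (mul_left_cancel₀ h3 h2)
  · rintro ⟨hWW, hs, hd, hch⟩
    have hblock := (iharaBlock_eq_iff hH hH' hV hWW hs hd).mpr hch
    have ho : Q.order = Q'.order := by rw [hWo, hWo', hWW]
    refine Polynomial.eq_of_infinite_eval_eq _ _ (((Set.Ioi_infinite (1 : ℝ)).image
      Complex.ofReal_injective.injOn).mono ?_)
    rintro _ ⟨u, hu, rfl⟩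
    have hu' : (1 : ℝ) < u := hu
    have h1 := ihara_join G H hG hH hGd hHd hm (hu'.trans_le (le_abs_self u))
    have h2 := ihara_join G H' hG hH' hGd hHd' hm' (hu'.trans_le (le_abs_self u))
    rw [← hP, ← hQ, SemiregularType.disc_congr hH.valid hH'.valid ho hs hd,
      SemiregularType.mass_congr hH.valid hH'.valid ho hs hd, hblock u hu', ← hQ', hs, hWW] at h1
    rw [← hP, ← hQ', ← h1] at h2
    have h3 : (((P.disc (Fintype.card W') (u ^ 2)
        * Q'.disc (Fintype.card V) (u ^ 2) : ℝ)) : ℂ) ≠ 0 := by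
      rw [Complex.ofReal_mul]
      exact mul_ne_zero (hdisc _ _ _ hW' hu'.le) (hdisc _ _ _ hV hu'.le)
    exact mul_left_cancel₀ (pow_ne_zero _ (hc u hu')) (mul_right_cancel₀ h3 h2.symm)

end OrientedEdgeGraph

namespace OrientedEdgeGraph

open Matrix

/-! ### What the spectrum of a join determines -/

section Charpoly

open Polynomial

variable {V W W' D E E' : Type*} [Fintype V] [DecidableEq V] [Fintype W] [DecidableEq W]
  [Fintype W'] [DecidableEq W'] [Fintype D] [Fintype E] [Fintype E']
  {G : OrientedEdgeGraph V D} {H : OrientedEdgeGraph W E} {H' : OrientedEdgeGraph W' E'}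
  {S : Finset V} {T : Finset W} {T' : Finset W'} {p q r s r' s' : ℕ}

theorem charpoly_join_eq_iff
    (hG : G.adjMatrix.IsSemiregular S p q) (hH : H.adjMatrix.IsSemiregular T r s)
    (hH' : H'.adjMatrix.IsSemiregular T' r' s') :
    (G.join H).adjMatrix.charpoly = (G.join H').adjMatrix.charpoly ↔
      Fintype.card W = Fintype.card W' ∧
      (semiregularType T r s).size = (semiregularType T' r' s').size ∧ r * s = r' * s' ∧
      H.adjMatrix.charpoly = H'.adjMatrix.charpoly := by
  have h1 := charpoly_join G H hG hH
  have h2 := charpoly_join G H' hG hH'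
  set P := semiregularType S p q with hP
  set Q := semiregularType T r s with hQ
  set Q' := semiregularType T' r' s' with hQ'
  have hmonic : ∀ k : ℂ, (X ^ 2 - C k : ℂ[X]).Monic := fun k =>
    monic_X_pow_sub_C k two_ne_zero
  have hA := hmonic ((p * q : ℕ) : ℂ)
  have hB := hmonic ((r * s : ℕ) : ℂ)
  have hB' := hmonic ((r' * s' : ℕ) : ℂ)
  constructor
  · intro hf
    have hW : Fintype.card W = Fintype.card W' := by
      have := congrArg natDegree hf
      simp only [charpoly_natDegree_eq_dim, Fintype.card_sum] at this
      omega
    rw [← hf] at h2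
    have hP1 : G.adjMatrix.charpoly ≠ 0 := (charpoly_monic _).ne_zero
    have hK := mul_left_cancel₀ hP1 (show G.adjMatrix.charpoly * (H.adjMatrix.charpoly
        * (X ^ 2 - C ((r' * s' : ℕ) : ℂ)) * ((X ^ 2 - C ((p * q : ℕ) : ℂ))
          * (X ^ 2 - C ((r * s : ℕ) : ℂ))
          - (C (Fintype.card V : ℂ) * X + C (2 * P.size : ℂ))
            * (C (Fintype.card W : ℂ) * X + C (2 * Q.size : ℂ))))
        = G.adjMatrix.charpoly * (H'.adjMatrix.charpoly
        * (X ^ 2 - C ((r * s : ℕ) : ℂ)) * ((X ^ 2 - C ((p * q : ℕ) : ℂ))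
          * (X ^ 2 - C ((r' * s' : ℕ) : ℂ))
          - (C (Fintype.card V : ℂ) * X + C (2 * P.size : ℂ))
            * (C (Fintype.card W' : ℂ) * X + C (2 * Q'.size : ℂ)))) by
      linear_combination (X ^ 2 - C ((r * s : ℕ) : ℂ)) * h2 - (X ^ 2 - C ((r' * s' : ℕ) : ℂ)) * h1)
    have hneg := congrArg (fun f : ℂ[X] => f.comp (-X)) hK
    simp only [mul_comp, sub_comp, add_comp, pow_comp, X_comp, C_comp, neg_sq,
      hH.charpoly_comp_neg, hH'.charpoly_comp_neg, hW, mul_assoc] at hneg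
    have hneg' := mul_left_cancel₀ (pow_ne_zero _ (neg_ne_zero.mpr one_ne_zero)) hneg
    rw [hW] at hK
    -- Under $X\mapsto -X$ the characteristic polynomials of `H` and `H'` change by the same sign,
    -- so subtracting the two forms isolates the odd part of each bracket: a constant times $X$.
    have hodd : H.adjMatrix.charpoly * (X ^ 2 - C ((r' * s' : ℕ) : ℂ))
          * C ((Fintype.card V * Q.size + Fintype.card W' * P.size : ℕ) : ℂ)
        = H'.adjMatrix.charpoly * (X ^ 2 - C ((r * s : ℕ) : ℂ))
          * C ((Fintype.card V * Q'.size + Fintype.card W' * P.size : ℕ) : ℂ) := by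
      refine mul_left_cancel₀ (mul_ne_zero (C_ne_zero.mpr (by norm_num : (4 : ℂ) ≠ 0)) X_ne_zero) ?_
      have h4 : (C 4 : ℂ[X]) = 2 * C 2 := by
        rw [show (2 : ℂ[X]) = C 2 from rfl, ← C_mul]
        norm_num
      rw [h4]
      simp only [Nat.cast_add, Nat.cast_mul, C_add, C_mul] at hK hneg' ⊢
      linear_combination hneg' - hK
    -- All the polynomial factors are monic, so the constants are the leading coefficients.
    have hsize : Fintype.card V * Q.size + Fintype.card W' * P.size
        = Fintype.card V * Q'.size + Fintype.card W' * P.size := by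
      have := congrArg leadingCoeff hodd
      rw [leadingCoeff_mul, leadingCoeff_mul, leadingCoeff_mul, leadingCoeff_mul, leadingCoeff_C,
        leadingCoeff_C, hB.leadingCoeff, hB'.leadingCoeff, (charpoly_monic _).leadingCoeff,
        (charpoly_monic _).leadingCoeff, one_mul, one_mul, one_mul] at this
      exact_mod_cast this
    have hVpos : 0 < Fintype.card V := hG.nonempty.card_pos.trans_le S.card_le_univ
    have hs : Q.size = Q'.size := Nat.eq_of_mul_eq_mul_left hVpos (by omega)
    by_cases h0 : Q.size = 0
    · have h4 : r = 0 := (hH.valid.degrees_eq_zero h0).1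
      have h5 : r' = 0 := (hH'.valid.degrees_eq_zero (hs ▸ h0)).1
      exact ⟨hW, hs, by rw [h4, h5, zero_mul, zero_mul], by
        rw [hH.charpoly_eq_X_pow h0, hH'.charpoly_eq_X_pow (hs ▸ h0), hW]⟩
    have hc : (C ((Fintype.card V * Q'.size + Fintype.card W' * P.size : ℕ) : ℂ) : ℂ[X]) ≠ 0 := by
      rw [Ne, C_eq_zero, Nat.cast_eq_zero, ← hs]
      have := mul_pos hVpos (Nat.pos_of_ne_zero h0)
      omega
    rw [hs] at hodd hK
    have hcross := mul_right_cancel₀ hc hodd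
    -- The odd identity makes the prefactors of the two brackets equal. The brackets then agree, and
    -- their products of quadratics reveal the degree product.
    rw [hcross] at hK
    have hKK := mul_left_cancel₀ (mul_ne_zero (charpoly_monic _).ne_zero hB.ne_zero) hK
    have hBB : (X ^ 2 - C ((r * s : ℕ) : ℂ) : ℂ[X]) = X ^ 2 - C ((r' * s' : ℕ) : ℂ) :=
      mul_left_cancel₀ hA.ne_zero (by linear_combination hKK)
    refine ⟨hW, hs, ?_, ?_⟩
    · exact_mod_cast C_injective (sub_right_injective hBB)
    · rw [hBB] at hcross
      exact mul_right_cancel₀ hB'.ne_zero hcross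
  · rintro ⟨hW, hs, hd, hch⟩
    rw [hd, hs, hW, hch, ← h2] at h1
    exact mul_right_cancel₀ (mul_ne_zero hA.ne_zero hB'.ne_zero) h1

end Charpoly

/-! ### Passage from spectra and zeta functions to polynomials -/

theorem spec_eq_iff {V W D E : Type*} [Fintype V] [DecidableEq V] [Fintype W] [DecidableEq W]
    (G : OrientedEdgeGraph V D) (H : OrientedEdgeGraph W E) :
    G.spec = H.spec ↔ G.adjMatrix.charpoly = H.adjMatrix.charpoly := by
  refine ⟨fun h => ?_, fun h => by rw [spec, spec, h]⟩
  rw [(IsAlgClosed.splits G.adjMatrix.charpoly).eq_prod_roots_of_monic (charpoly_monic _),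
    (IsAlgClosed.splits H.adjMatrix.charpoly).eq_prod_roots_of_monic (charpoly_monic _)]
  exact congrArg (fun s : Multiset ℂ => (s.map fun a => Polynomial.X - Polynomial.C a).prod) h

theorem eventually_zeta_eq_iff {V W D E : Type*} [Fintype D] [DecidableEq D] [Fintype E]
    [DecidableEq E] (G : OrientedEdgeGraph V D) (H : OrientedEdgeGraph W E) :
    (∀ᶠ u in 𝓝 (0 : ℂ), G.zeta u = H.zeta u) ↔
      (ofRel G.Follows).charpolyRev = (ofRel H.Follows).charpolyRev := by
  have hG := G.eventually_hasProd_zetaFactor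
  have hH := H.eventually_hasProd_zetaFactor
  constructor
  · intro h
    refine Polynomial.eq_of_infinite_eval_eq _ _ (infinite_of_mem_nhds (0 : ℂ) ?_)
    filter_upwards [h, hG, hH] with u h1 h2 h3
    rw [zeta, zeta, h2.tprod_eq, h3.tprod_eq] at h1
    rw [eval_charpolyRev_eq, eval_charpolyRev_eq, inv_injective h1]
  · intro h
    filter_upwards [hG, hH] with u h2 h3
    rw [zeta, zeta, h2.tprod_eq, h3.tprod_eq, ← eval_charpolyRev_eq, ← eval_charpolyRev_eq, h]

end OrientedEdgeGraph
theorem theorem5p1 {V₁ D₁ V₂ D₂ V₂' D₂' : Type*}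
    [Fintype V₁] [DecidableEq V₁] [Finite D₁]
    [Fintype V₂] [DecidableEq V₂] [Finite D₂]
    [Fintype V₂'] [DecidableEq V₂'] [Finite D₂']
    (G₁ : OrientedEdgeGraph V₁ D₁) (G₂ : OrientedEdgeGraph V₂ D₂)
    (G₂' : OrientedEdgeGraph V₂' D₂')
    (q₁ q₂ q₃ q₄ q₃' q₄' : ℕ)
    (h₁ : G₁.IsSemiregularBipartite q₁ q₂)
    (h₂ : G₂.IsSemiregularBipartite q₃ q₄)
    (h₂' : G₂'.IsSemiregularBipartite q₃' q₄') :
    (∀ᶠ u in 𝓝 (0 : ℂ), Multipliable ((G₁.join G₂).zetaFactor u)) ∧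
    (∀ᶠ u in 𝓝 (0 : ℂ), Multipliable ((G₁.join G₂').zetaFactor u)) ∧
    ((∀ᶠ u in 𝓝 (0 : ℂ), (G₁.join G₂).zeta u = (G₁.join G₂').zeta u) ↔
      (G₁.join G₂).spec = (G₁.join G₂').spec) := by
  classical
  have := Fintype.ofFinite D₁
  have := Fintype.ofFinite D₂
  have := Fintype.ofFinite D₂'
  obtain ⟨S, hS, hD, hdeg⟩ := h₁.exists_isSemiregular
  obtain ⟨T, hT, hE, hdegT⟩ := h₂.exists_isSemiregular
  obtain ⟨T', hT', hE', hdegT'⟩ := h₂'.exists_isSemiregular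
  refine ⟨?_, ?_, ?_⟩
  · filter_upwards [(G₁.join G₂).eventually_hasProd_zetaFactor] with u hu using hu.multipliable
  · filter_upwards [(G₁.join G₂').eventually_hasProd_zetaFactor] with u hu using hu.multipliable
  · rw [OrientedEdgeGraph.eventually_zeta_eq_iff, OrientedEdgeGraph.spec_eq_iff,
      OrientedEdgeGraph.charpoly_join_eq_iff hS hT hT',
      OrientedEdgeGraph.charpolyRev_join_eq_iff hS hT hT' hdeg hdegT hdegT' hD hE hE']
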